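/- **Setting.** Let $T$ be a countable set, $\pi:T\to T$ and $\phi\in T$ such that: $\pi$ has at most one periodic point; any $w,v\in T$ satisfy $\pi^n(w)=\pi^m(v)$ for some $n,m\ge 0$; and $\phi$ is the periodic point of $\pi$ if there is one. Put $b(w,v)=\min\{n\ge0 : \pi^n(w)=\pi^m(v)\text{ for some }m\ge0\}$, $[w]=b(w,\phi)-b(\phi,w)\in\mathbb Z$, $T_n=\{w\in T:[w]=n\}$, and $\acute\pi^{-k}(w)=\{v\in T:\pi^k(v)=w,\ [v]=[w]+k\}$ for $k\ge 0$. Let $(X,R)$ be a metric space without isolated points, and let $K:T\to\mathfrak P(X)$, $w\mapsto K_w$, be a partition of it: every $K_w$ is compact and has at least two points, $\bigcup_{w\in T_0}K_w=X$, $\bigcup_{v\in\acute\pi^{-1}(w)}K_v=K_w$ for every $w$, and $\bigcap_{k\in\mathbb Z}K_{w_k}$ is a single point for every non-constant sequence $(w_k)_{k\in\mathbb Z}$ in $T$ with $\pi(w_{k+1})=w_k$ for all $k$. Assume that $K$ satisfies the basic framework with ratio $\zeta\in(0,1)$, that is: * $\sup_{w}\#\acute\pi^{-1}(w)<\infty$,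 and $\mathrm{int}(K_w)\cap \mathrm{int}(K_v)=\emptyset$ whenever $[w]=[v]$ and $w\neq v$; * $\mathrm{diam}(K_w)\asymp\zeta^{[w]}$ for $w\in T$, and for some $\xi>0$ every $K_w$ contains a ball $B(x_w,\xi\zeta^{[w]})$ with $x_w\in K_w$; * with $E_n=\{(w,v)\in T_n\times T_n: w\ne v,\ K_w\cap K_v\neq\emptyset\}$, with $l_n$ the graph distance of $(T_n,E_n)$ (possibly $\infty$), and with $\Delta_m(x,y)=\sup\{n : x\in K_w,\ y\in K_v,\ l_n(w,v)\le m\text{ for some }w,v\in T_n\}$, there is an integer $M_*\ge1$ such that $R(x,y)\asymp\zeta^{\Delta_{M_*}(x,y)}$ for $x,y\in X$; * $\sup_{w}\#\{v:(w,v)\in E_{[w]}\}<\infty$. Let $N_*=\limsup_{k\to\infty}\bigl(\sup_{w\in T}\#\acute\pi^{-k}(w)\bigr)^{1/k}$. A Borel measure $\mu$ on $X$ is called doubling if there is $C>1$ with $0<\mu(B(x,2r))\le C\mu(B(x,r))<\infty$ for all $x\in X$ and $r>0$, where $B(x,r)$ is the open ball. Write $V_\mu(x,r)=\mu(B(x,r))$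 and $$F_\mu(k)=\sup_{x\in X,\ 0<r<\mathrm{diam}(X)}\frac{V_\mu(x,r)}{V_\mu(x,\zeta^k r)},$$ where $\mathrm{diam}(X)$ may be $\infty$. **Proposition 3.11.** 1. There is a constant $c>0$ such that $F_\mu(k)\ge c\,N_*^k$ for every doubling Borel measure $\mu$ on $X$ and every integer $k\ge0$. 2. For every $\varepsilon>0$ there are a doubling Borel measure $\mu$ on $X$ and a constant $C>0$ such that $F_\mu(k)\le C\,(N_*+\varepsilon)^k$ for every integer $k\ge0$. -/

import Mathlib

open Set Filter Topology MeasureTheory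
open scoped NNReal ENNReal

/-- `(T, π, φ)` is a tree with a reference point: `T` is countable, `π` (the parent map) has at most
one periodic point, any two points have a common iterate, and `φ` is the periodic point if there is
one (any point otherwise). -/
structure IsRefTree {T : Type*} (π : T → T) (φ : T) : Prop where
  countable : Countable T
  periodic_subsingleton : (Function.periodicPts π).Subsingleton
  common_ancestor : ∀ w v : T, ∃ n m : ℕ, π^[n] w = π^[m] v
  ref_mem : (Function.periodicPts π).Nonempty → φ ∈ Function.periodicPts π

/-- `b(w, v) = min {n ≥ 0 | π^n(w) = π^m(v) for some m ≥ 0}`. -/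
noncomputable def treeB {T : Type*} (π : T → T) (w v : T) : ℕ :=
  sInf {n : ℕ | ∃ m : ℕ, π^[n] w = π^[m] v}

/-- The level `[w] = b(w, φ) - b(φ, w)`, an integer. -/
noncomputable def treeLevel {T : Type*} (π : T → T) (φ w : T) : ℤ :=
  (treeB π w φ : ℤ) - (treeB π φ w : ℤ)

/-- The `k`-th generation descendants of `w`: the points `v` with `π^k(v) = w` and
`[v] = [w] + k`. -/
def descendants {T : Type*} (π : T → T) (φ : T) (k : ℕ) (w : T) : Set T :=
  {v | π^[k] v = w ∧ treeLevel π φ v = treeLevel π φ w + k}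

/-- `K` is a partition of the metric space `X` parametrized by the tree `(T, π, φ)`.
In the last condition constant sequences are excluded: they exist only if `π φ = φ` (namely the
sequence constantly equal to `φ`), and there the intersection is the whole space. -/
structure IsTreePartition {X T : Type*} [MetricSpace X] (π : T → T) (φ : T) (K : T → Set X) :
    Prop where
  no_isolated : ∀ x : X, (𝓝[≠] x).NeBot
  isCompact : ∀ w, IsCompact (K w)
  /-- neither empty nor a single point -/
  nontrivial : ∀ w, (K w).Nontrivial
  cover : ⋃ w ∈ {w : T | treeLevel π φ w = 0}, K w = univ
  subdivide : ∀ w, ⋃ v ∈ descendants π φ 1 w, K v = K w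
  inter_singleton : ∀ w : ℤ → T, (∀ k, π (w (k + 1)) = w k) → (∃ k, w (k + 1) ≠ w k) →
    ∃ x, ⋂ k, K (w k) = {x}

/-- The disjoint union over `n` of the graphs `(T_n, E_n)`, where `T_n` is the set of points of
level `n` and distinct `w, v ∈ T_n` are adjacent if `K w` meets `K v`. All walks stay inside one
level, so its extended graph distance restricts to the graph distance of `(T_n, E_n)` on `T_n`. -/
def cellGraph {X T : Type*} (π : T → T) (φ : T) (K : T → Set X) : SimpleGraph T where
  Adj w v := treeLevel π φ w = treeLevel π φ v ∧ w ≠ v ∧ (K w ∩ K v).Nonempty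
  symm := ⟨fun _ _ h => ⟨h.1.symm, h.2.1.symm, by rw [Set.inter_comm]; exact h.2.2⟩⟩
  loopless := ⟨fun _ h => h.2.1 rfl⟩

/-- The set of levels `n` for which there are `w, v ∈ T_n` with `x ∈ K w`, `y ∈ K v` at graph
distance at most `m` in `(T_n, E_n)`. Its supremum is `Δ_m(x, y)`. -/
def linkedLevels {X T : Type*} (π : T → T) (φ : T) (K : T → Set X) (m : ℕ) (x y : X) : Set ℤ :=
  {n | ∃ w v : T, treeLevel π φ w = n ∧ treeLevel π φ v = n ∧ x ∈ K w ∧ y ∈ K v ∧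
    (cellGraph π φ K).edist w v ≤ m}

/-- The partition `K` satisfies the basic framework, with scaling ratio `ζ`. -/
structure SatisfiesBasicFramework {X T : Type*} [MetricSpace X] (π : T → T) (φ : T)
    (K : T → Set X) (ζ : ℝ) : Prop where
  tree : IsRefTree π φ
  children_bounded : ∃ N : ℕ, ∀ w, (descendants π φ 1 w).encard ≤ N
  partition : IsTreePartition π φ K
  interior_disjoint : ∀ w v, treeLevel π φ w = treeLevel π φ v → w ≠ v →
    interior (K w) ∩ interior (K v) = ∅
  ratio_pos : 0 < ζ
  ratio_lt_one : ζ < 1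
  diam_comparable : ∃ c C : ℝ, 0 < c ∧ 0 < C ∧ ∀ w,
    c * ζ ^ treeLevel π φ w ≤ Metric.diam (K w) ∧ Metric.diam (K w) ≤ C * ζ ^ treeLevel π φ w
  inner_ball : ∃ ξ : ℝ, 0 < ξ ∧ ∀ w, ∃ x ∈ K w, Metric.ball x (ξ * ζ ^ treeLevel π φ w) ⊆ K w
  /-- `ρ(x, y) ≍ ζ ^ Δ_M(x, y)` for some `M`; for `x ≠ y` this forces the supremum `Δ_M(x, y)` to be
  finite, hence a maximum `n`, and for `x = y` both sides vanish (`Δ_M(x, x) = ∞`). -/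
  dist_comparable : ∃ M : ℕ, 1 ≤ M ∧ ∃ c C : ℝ, 0 < c ∧ 0 < C ∧ ∀ x y : X, x ≠ y →
    ∃ n : ℤ, IsGreatest (linkedLevels π φ K M x y) n ∧
      c * ζ ^ n ≤ dist x y ∧ dist x y ≤ C * ζ ^ n
  neighbors_bounded : ∃ L : ℕ, ∀ w, ((cellGraph π φ K).neighborSet w).encard ≤ L

/-- `N_* = limsup_{k → ∞} (sup_w #(k-th generation descendants of w)) ^ (1/k)`, computed in
`[0, ∞]`. -/
noncomputable def NStar {T : Type*} (π : T → T) (φ : T) : ℝ≥0∞ :=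
  limsup (fun k : ℕ => ((⨆ w, (descendants π φ k w).encard : ℕ∞) : ℝ≥0∞) ^ (1 / (k : ℝ))) atTop

/-- `μ` has the volume doubling property:
`0 < μ(B(x, 2r)) ≤ C μ(B(x, r)) < ∞` for all `x` and `r > 0`, for some `C > 1`. -/
def IsVolumeDoubling {X : Type*} [MetricSpace X] [MeasurableSpace X] (μ : Measure X) : Prop :=
  ∃ C : ℝ≥0, 1 < C ∧ ∀ (x : X) (r : ℝ), 0 < r →
    0 < μ (Metric.ball x (2 * r)) ∧ μ (Metric.ball x (2 * r)) ≤ C * μ (Metric.ball x r) ∧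
      C * μ (Metric.ball x r) < ∞

/-- `sup V_μ(x, r) / V_μ(x, ζ^k r)` over `x ∈ X` and `0 < r < diam X`, where `diam X` may be `∞`. -/
noncomputable def volumeRatioSup {X : Type*} [MetricSpace X] [MeasurableSpace X] (μ : Measure X)
    (ζ : ℝ) (k : ℕ) : ℝ≥0∞ :=
  ⨆ (x : X) (r : ℝ) (_ : 0 < r ∧ ENNReal.ofReal r < Metric.ediam (univ : Set X)),
    μ (Metric.ball x r) / μ (Metric.ball x (ζ ^ k * r))

/-! Write D_k for the largest number of k-th generation descendants (`maxDescendants`). Since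
D_{k+l} ≤ D_k D_l, Fekete's argument gives N_*^k ≤ D_k for every k (`NStar_pow_le`), while 2 D_k ≤
(N_* + ε)^k for all large k (`eventually_maxDescendants_le`).

Lower bound. The k-th generation descendants v of w carry disjoint balls B_v ⊆ K_v of radius ≍
ζ^([w]+k). Enlarged by the factor ζ^-(k+j), for a fixed j, each of them contains K_w. Summing μ(K_w)
≤ F_μ(k+j) μ(B_v) over v and cancelling μ(K_w) bounds the number of descendants by F_μ(k+j), with
constants that do not depend on μ.

Upper bound. Fix a large m with 2 D_m ≤ (N_* + ε)^m, put N = D_m, and use only levels divisible by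
m. Splitting each mass equally among the children loses at most a factor N per step, but
neighbouring cells with different parents may drift apart. So after each split every cell gives the
proportion δ = 1/(4LN) of its mass to each close cell, where L bounds the number of close cells
(`massTransport`). The comparison h w ≤ 8LN · h v for close cells then reproduces itself
(`massTransport_le_mul`), and a child still has at least 1/(2N) of its parent's mass
(`par_le_massTransport`). The tree may have no top level, so a consistent family of masses is a
limit of families started ever higher (`exists_isMassFamily`).

Placing the masses at points of the cells gives a measure for each level. One transport moves mass
by a distance of the order of the cell size, and these distances sum geometrically, so a vague limit
μ gives balls of radius about ζ^[w] a mass comparable to h w (`exists_measure_of_massFamily`).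
Passing from radius r to ζ^k r takes about k/m steps, each costing at most 2N ≤ (N_* + ε)^m.
Doubling is the same estimate for one k with ζ^k < 1/2. -/

section Levels

/-! ### Levels in the tree. -/

variable {T : Type*} {π : T → T} {φ : T}

namespace IsRefTree

/-- `π` maps periodic points to periodic points, so a unique one is fixed. Two cases result: `π φ =
φ`, a rooted tree with levels `≥ 0`, or no periodic point at all, with levels unbounded below. -/
lemma isFixedPt_of_mem_periodicPts (h : IsRefTree π φ) {x : T}
    (hx : x ∈ Function.periodicPts π) : π x = x :=
  h.periodic_subsingleton ((Function.bijOn_periodicPts π).mapsTo hx) hx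

lemma isFixedPt_ref_of_nonempty (h : IsRefTree π φ) (hp : (Function.periodicPts π).Nonempty) :
    π φ = φ :=
  h.isFixedPt_of_mem_periodicPts (h.ref_mem hp)

lemma eq_ref_of_isFixedPt (h : IsRefTree π φ) {w : T} (hw : π w = w) : w = φ := by
  have hw' : w ∈ Function.periodicPts π := Function.mk_mem_periodicPts one_pos hw
  exact h.periodic_subsingleton hw' (h.ref_mem ⟨w, hw'⟩)

lemma periodicPts_eq_empty (h : IsRefTree π φ) (hφ : π φ ≠ φ) (x : T) :
    x ∉ Function.periodicPts π :=
  fun hx => hφ (h.isFixedPt_ref_of_nonempty ⟨x, hx⟩)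

lemma iterate_injective (h : IsRefTree π φ) (hφ : π φ ≠ φ) {a b : ℕ} {x : T}
    (hab : π^[a] x = π^[b] x) : a = b := by
  wlog hle : a ≤ b generalizing a b
  · exact (this hab.symm (by omega)).symm
  by_contra hne
  refine h.periodicPts_eq_empty hφ (π^[a] x) (Function.mk_mem_periodicPts (n := b - a) (by omega) ?_)
  change π^[b - a] (π^[a] x) = π^[a] x
  rw [← Function.iterate_add_apply, Nat.sub_add_cancel hle, hab]

/-- Orbits never repeat without periodic points, so all meeting times of `w` and `v` have the same
difference. Hence the level can be read off any common iterate with `φ`. -/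
lemma sub_eq_sub_of_iterate_eq (h : IsRefTree π φ) (hφ : π φ ≠ φ) {w v : T} {a b c d : ℕ}
    (h1 : π^[a] w = π^[b] v) (h2 : π^[c] w = π^[d] v) : (a : ℤ) - b = c - d := by
  have e : π^[c + b] v = π^[a + d] v := by
    rw [Function.iterate_add_apply, ← h1, ← Function.iterate_add_apply, add_comm c a,
      Function.iterate_add_apply, h2, ← Function.iterate_add_apply]
  have := h.iterate_injective hφ e
  omega

lemma treeB_spec (h : IsRefTree π φ) (w v : T) : ∃ m, π^[treeB π w v] w = π^[m] v :=
  Nat.sInf_mem (s := {n : ℕ | ∃ m : ℕ, π^[n] w = π^[m] v}) (by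
    obtain ⟨n, m, e⟩ := h.common_ancestor w v
    exact ⟨n, m, e⟩)

lemma treeB_le {w v : T} {n m : ℕ} (e : π^[n] w = π^[m] v) : treeB π w v ≤ n :=
  Nat.sInf_le ⟨m, e⟩

lemma treeLevel_of_iterate_eq (h : IsRefTree π φ) (hφ : π φ ≠ φ) {w : T} {a b : ℕ}
    (e : π^[a] w = π^[b] φ) : treeLevel π φ w = a - b := by
  obtain ⟨m, hm⟩ := h.treeB_spec w φ
  obtain ⟨n, hn⟩ := h.treeB_spec φ w
  have h1 := treeB_le (π := π) hn.symm
  have h2 := treeB_le (π := π) hm.symm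
  have h3 := h.sub_eq_sub_of_iterate_eq hφ hm e
  have h4 := h.sub_eq_sub_of_iterate_eq hφ hn.symm e
  unfold treeLevel
  omega

lemma treeLevel_map_of_free (h : IsRefTree π φ) (hφ : π φ ≠ φ) (w : T) :
    treeLevel π φ (π w) = treeLevel π φ w - 1 := by
  obtain ⟨n, m, e⟩ := h.common_ancestor w φ
  rw [h.treeLevel_of_iterate_eq hφ e, h.treeLevel_of_iterate_eq hφ (a := n) (b := m + 1)]
  · push_cast; ring
  · rw [← Function.iterate_succ_apply, Function.iterate_succ_apply', e,
      ← Function.iterate_succ_apply' π]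

lemma treeLevel_of_fixed (hφ : π φ = φ) (w : T) :
    treeLevel π φ w = treeB π w φ := by
  have : treeB π φ w ≤ 0 ∨ ¬ ∃ m, φ = π^[m] w := by
    by_cases hm : ∃ m, φ = π^[m] w
    · obtain ⟨m, hm⟩ := hm
      exact Or.inl (treeB_le (m := m) hm)
    · exact Or.inr hm
  have h0 : treeB π φ w = 0 := by
    rcases this with h | h
    · omega
    · unfold treeB
      -- Here the set is empty and `sInf` takes its default value `0`, so no tree axiom is needed.
      rw [Nat.sInf_eq_zero]
      right
      ext n
      simp only [mem_ofPred_eq, mem_empty_iff_false, iff_false]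
      rintro ⟨m, e⟩
      exact h ⟨m, by rw [← e, Function.iterate_fixed hφ]⟩
  simp [treeLevel, h0]

lemma iterate_treeLevel_of_fixed (h : IsRefTree π φ) (hφ : π φ = φ) (w : T) :
    π^[(treeLevel π φ w).toNat] w = φ := by
  obtain ⟨m, hm⟩ := h.treeB_spec w φ
  rw [treeLevel_of_fixed hφ, Int.toNat_natCast, hm, Function.iterate_fixed hφ]

lemma treeLevel_ref : treeLevel π φ φ = 0 := by
  simp [treeLevel]

lemma treeLevel_nonneg (hφ : π φ = φ) (w : T) : 0 ≤ treeLevel π φ w := by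
  rw [treeLevel_of_fixed hφ]; positivity

lemma eq_ref_of_treeLevel_eq_zero (h : IsRefTree π φ) (hφ : π φ = φ) {w : T}
    (hw : treeLevel π φ w = 0) : w = φ := by
  have := h.iterate_treeLevel_of_fixed hφ w
  rwa [hw] at this

lemma treeLevel_map_of_fixed (h : IsRefTree π φ) (hφ : π φ = φ) {w : T} (hw : w ≠ φ) :
    treeLevel π φ (π w) = treeLevel π φ w - 1 := by
  have h1 := h.iterate_treeLevel_of_fixed hφ w
  have h2 := h.iterate_treeLevel_of_fixed hφ (π w)
  have hpos : 0 < treeLevel π φ w := lt_of_le_of_ne (treeLevel_nonneg hφ w)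
    fun h0 => hw (h.eq_ref_of_treeLevel_eq_zero hφ h0.symm)
  obtain ⟨n, hn⟩ : ∃ n : ℕ, treeLevel π φ w = n + 1 := ⟨(treeLevel π φ w).toNat - 1, by omega⟩
  obtain ⟨k, hk⟩ : ∃ k : ℕ, treeLevel π φ (π w) = k :=
    ⟨(treeLevel π φ (π w)).toNat, by have := treeLevel_nonneg hφ (π w); omega⟩
  rw [hn, show ((n : ℤ) + 1).toNat = n + 1 by omega, Function.iterate_succ_apply] at h1
  rw [hk, Int.toNat_natCast, ← Function.iterate_succ_apply] at h2
  have h3 : treeB π (π w) φ ≤ n := treeB_le (m := 0) h1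
  have h4 : treeB π w φ ≤ k + 1 := treeB_le (m := 0) h2
  rw [treeLevel_of_fixed hφ] at *
  rw [treeLevel_of_fixed hφ] at *
  omega

lemma treeLevel_map (h : IsRefTree π φ) {w : T} (hw : π w ≠ w) :
    treeLevel π φ (π w) = treeLevel π φ w - 1 := by
  by_cases hφ : π φ = φ
  · exact h.treeLevel_map_of_fixed hφ fun e => hw (by rw [e, hφ])
  · exact h.treeLevel_map_of_free hφ w

lemma sub_one_le_treeLevel_map (h : IsRefTree π φ) (w : T) :
    treeLevel π φ w - 1 ≤ treeLevel π φ (π w) := by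
  by_cases hw : π w = w
  · rw [hw]; omega
  · rw [h.treeLevel_map hw]

lemma sub_le_treeLevel_iterate (h : IsRefTree π φ) (k : ℕ) (w : T) :
    treeLevel π φ w - k ≤ treeLevel π φ (π^[k] w) := by
  induction k with
  | zero => simp
  | succ k ih =>
    rw [Function.iterate_succ_apply']
    have := h.sub_one_le_treeLevel_map (π^[k] w)
    push_cast; omega

lemma treeLevel_iterate_of_free (h : IsRefTree π φ) (hφ : π φ ≠ φ) (k : ℕ) (w : T) :
    treeLevel π φ (π^[k] w) = treeLevel π φ w - k := by
  induction k with
  | zero => simp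
  | succ k ih =>
    rw [Function.iterate_succ_apply', h.treeLevel_map_of_free hφ, ih]
    push_cast; ring

lemma treeLevel_iterate_of_fixed (h : IsRefTree π φ) (hφ : π φ = φ) (k : ℕ) (w : T) :
    treeLevel π φ (π^[k] w) = max (treeLevel π φ w - k) 0 := by
  induction k with
  | zero => simpa using treeLevel_nonneg hφ w
  | succ k ih =>
    rw [Function.iterate_succ_apply']
    by_cases e : π^[k] w = φ
    · rw [e] at ih ⊢
      rw [hφ, IsRefTree.treeLevel_ref] at *
      push_cast; omega
    · rw [h.treeLevel_map_of_fixed hφ e, ih]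
      have h1 := treeLevel_nonneg hφ (π^[k] w)
      have h2 : treeLevel π φ (π^[k] w) ≠ 0 := fun e' => e (h.eq_ref_of_treeLevel_eq_zero hφ e')
      push_cast; omega

/-- In both cases the level after the steps depends only on the starting level minus the number of
steps (truncated at `0` in a rooted tree). Cells of different depths can thus be lifted to one level
without a case distinction. -/
lemma treeLevel_iterate_congr (h : IsRefTree π φ) {w v : T} {p q : ℕ}
    (e : treeLevel π φ w - p = treeLevel π φ v - q) :
    treeLevel π φ (π^[p] w) = treeLevel π φ (π^[q] v) := by
  by_cases hφ : π φ = φ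
  · rw [h.treeLevel_iterate_of_fixed hφ, h.treeLevel_iterate_of_fixed hφ, e]
  · rw [h.treeLevel_iterate_of_free hφ, h.treeLevel_iterate_of_free hφ, e]

/-- If the level `n` is inhabited, then `π ^ k` maps the level `n + k` to the level `n`. -/
lemma treeLevel_iterate_of_inhabited (h : IsRefTree π φ) {u y : T} {k : ℕ}
    (e : treeLevel π φ y = treeLevel π φ u + k) :
    treeLevel π φ (π^[k] y) = treeLevel π φ u := by
  have := h.treeLevel_iterate_congr (w := y) (v := u) (p := k) (q := 0) (by push_cast; omega)
  simpa using this

/-- A step lowers the level by at most one; if `k + l` steps lose `k + l` levels, every step loses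
exactly one. -/
lemma treeLevel_iterate_eq_of_add_eq (h : IsRefTree π φ) {v w : T} {k l : ℕ}
    (hv : π^[k + l] v = w) (hl : treeLevel π φ v = treeLevel π φ w + (k + l : ℕ)) :
    treeLevel π φ (π^[l] v) = treeLevel π φ w + k := by
  have h1 := h.sub_le_treeLevel_iterate l v
  have h2 := h.sub_le_treeLevel_iterate k (π^[l] v)
  rw [← Function.iterate_add_apply, hv] at h2
  push_cast at hl; omega

lemma descendants_add (h : IsRefTree π φ) (k l : ℕ) (w : T) :
    descendants π φ (k + l) w = ⋃ v ∈ descendants π φ k w, descendants π φ l v := by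
  ext u
  simp only [descendants, mem_ofPred_eq, mem_iUnion, exists_prop]
  constructor
  · rintro ⟨h1, h2⟩
    have := h.treeLevel_iterate_eq_of_add_eq h1 h2
    exact ⟨π^[l] u, ⟨by rw [← Function.iterate_add_apply, h1], this⟩, rfl, by push_cast at *; omega⟩
  · rintro ⟨v, ⟨h1, h2⟩, h3, h4⟩
    exact ⟨by rw [Function.iterate_add_apply, h3, h1], by push_cast; omega⟩

lemma descendants_zero (w : T) : descendants π φ 0 w = {w} := by
  ext v
  simp only [descendants, Function.iterate_zero, id, mem_ofPred_eq, mem_singleton_iff]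
  constructor
  · exact fun h => h.1
  · rintro rfl; simp

/-- Masses will live only on levels divisible by `m`, so `w` and `φ` have to be joined by chains of
`m`-step parents. -/
lemma exists_common_iterate (h : IsRefTree π φ) {m : ℕ} (w : T)
    (hw : (m : ℤ) ∣ treeLevel π φ w) (hm : 0 < m) :
    ∃ a b : ℕ, π^[m * a] w = π^[m * b] φ ∧ treeLevel π φ (π^[m * a] w) = treeLevel π φ w - m * a ∧
      treeLevel π φ (π^[m * b] φ) = - (m * b : ℤ) := by
  by_cases hφ : π φ = φ
  · obtain ⟨i, hi⟩ := hw
    have h0 := treeLevel_nonneg hφ w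
    have hi0 : 0 ≤ i := by
      by_contra hneg
      have : (m : ℤ) * i < 0 := mul_neg_of_pos_of_neg (by exact_mod_cast hm) (by omega)
      omega
    lift i to ℕ using hi0
    have e : (treeLevel π φ w).toNat = m * i := by rw [hi]; norm_cast
    have e2 := h.iterate_treeLevel_of_fixed hφ w
    rw [e] at e2
    refine ⟨i, 0, by simpa using e2, ?_, by simpa using IsRefTree.treeLevel_ref⟩
    rw [e2, IsRefTree.treeLevel_ref, hi]; ring
  · obtain ⟨a, b, e⟩ := h.common_ancestor w φ
    have hl := h.treeLevel_of_iterate_eq hφ e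
    obtain ⟨i, hi⟩ := hw
    have hdiv : (m : ℤ) ∣ (a - b) := ⟨i, by omega⟩
    -- shift the common iterate to a multiple of `m`
    have hma : m * a = (m * a - a) + a := by
      have : a ≤ m * a := Nat.le_mul_of_pos_left a hm
      omega
    have hb : ∃ b' : ℕ, m * b' = (m * a - a) + b := by
      have : (m : ℤ) ∣ (m * a - a) + b := by
        have h2 : ((m : ℤ) * a - a) + b = m * a - (a - b) := by ring
        rw [h2]; exact dvd_sub (dvd_mul_right _ _) hdiv
      have h3 : m ∣ (m * a - a) + b := by
        have hle : a ≤ m * a := Nat.le_mul_of_pos_left a hm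
        zify [hle]; exact this
      obtain ⟨b', hb'⟩ := h3
      exact ⟨b', hb'.symm⟩
    obtain ⟨b', hb'⟩ := hb
    refine ⟨a, b', ?_, ?_, ?_⟩
    · rw [hma, hb', Function.iterate_add_apply, e, ← Function.iterate_add_apply]
    · rw [h.treeLevel_iterate_of_free hφ]; push_cast; ring
    · rw [h.treeLevel_iterate_of_free hφ, IsRefTree.treeLevel_ref]; push_cast; ring

end IsRefTree

end Levels

/-! ### Geometry of cells: touching, closeness, properness. -/

section Cells

lemma encard_biUnion_le_mul {α β : Type*} {S : Set α} (hS : S.Finite) {D : α → Set β} {B : ℕ∞}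
    (hD : ∀ i ∈ S, (D i).encard ≤ B) : (⋃ i ∈ S, D i).encard ≤ S.encard * B := by
  induction S, hS using Set.Finite.induction_on with
  | empty => simp
  | @insert a s ha _ ih =>
    rw [biUnion_insert, encard_insert_of_notMem ha, add_mul, one_mul, add_comm]
    refine (encard_union_le _ _).trans (add_le_add (hD a (mem_insert _ _)) (ih fun i hi => ?_))
    exact hD i (mem_insert_of_mem _ hi)

variable {X T : Type*} [MetricSpace X] {π : T → T} {φ : T} {K : T → Set X} {ζ : ℝ}

/-- Two cells of the same level that meet (a cell touches itself). -/
def CellTouch (π : T → T) (φ : T) (K : T → Set X) (w v : T) : Prop :=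
  treeLevel π φ w = treeLevel π φ v ∧ (K w ∩ K v).Nonempty

/-- The cells that can be reached from `w` by a chain of `k` touching cells. -/
def touchBall (π : T → T) (φ : T) (K : T → Set X) : ℕ → T → Set T
  | 0, w => {w}
  | k + 1, w => ⋃ v ∈ {v | CellTouch π φ K w v}, touchBall π φ K k v

/-- Two cells of the same level `n` whose distance is at most `H * ζ ^ n`. -/
def CellClose (π : T → T) (φ : T) (K : T → Set X) (ζ H : ℝ) (w v : T) : Prop :=
  treeLevel π φ w = treeLevel π φ v ∧
    ∃ x ∈ K w, ∃ y ∈ K v, dist x y ≤ H * ζ ^ treeLevel π φ w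

lemma CellClose.symm {H : ℝ} {w v : T} (h : CellClose π φ K ζ H w v) :
    CellClose π φ K ζ H v w := by
  obtain ⟨h1, x, hx, y, hy, h2⟩ := h
  exact ⟨h1.symm, y, hy, x, hx, by rw [dist_comm, ← h1]; exact h2⟩

namespace SatisfiesBasicFramework

lemma zpow_pos (hK : SatisfiesBasicFramework π φ K ζ) (n : ℤ) : 0 < ζ ^ n :=
  _root_.zpow_pos hK.ratio_pos n

lemma nonempty (hK : SatisfiesBasicFramework π φ K ζ) (w : T) : (K w).Nonempty :=
  (hK.partition.nontrivial w).nonempty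

lemma cell_subset_map (hK : SatisfiesBasicFramework π φ K ζ) (w : T) : K w ⊆ K (π w) := by
  by_cases hw : π w = w
  · rw [hw]
  · rw [← hK.partition.subdivide (π w)]
    refine subset_biUnion_of_mem (u := K) (show w ∈ descendants π φ 1 (π w) from ⟨rfl, ?_⟩)
    rw [hK.tree.treeLevel_map hw]; push_cast; ring

lemma cell_subset_iterate (hK : SatisfiesBasicFramework π φ K ζ) (k : ℕ) (w : T) :
    K w ⊆ K (π^[k] w) := by
  induction k with
  | zero => exact Subset.rfl
  | succ k ih =>
    rw [Function.iterate_succ_apply']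
    exact ih.trans (hK.cell_subset_map _)

lemma cell_subset_of_mem_descendants (hK : SatisfiesBasicFramework π φ K ζ) {k : ℕ} {v w : T}
    (h : v ∈ descendants π φ k w) : K v ⊆ K w := by
  rw [← h.1]; exact hK.cell_subset_iterate k v

lemma exists_mem_descendants (hK : SatisfiesBasicFramework π φ K ζ) (k : ℕ) {w : T} {x : X}
    (hx : x ∈ K w) : ∃ v ∈ descendants π φ k w, x ∈ K v := by
  induction k with
  | zero => exact ⟨w, by simp [IsRefTree.descendants_zero], hx⟩
  | succ k ih =>
    obtain ⟨v, hv, hxv⟩ := ih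
    rw [← hK.partition.subdivide v] at hxv
    simp only [mem_iUnion, exists_prop] at hxv
    obtain ⟨u, hu, hxu⟩ := hxv
    refine ⟨u, ?_, hxu⟩
    rw [hK.tree.descendants_add]
    exact mem_biUnion hv hu

lemma descendants_nonempty (hK : SatisfiesBasicFramework π φ K ζ) (k : ℕ) (w : T) :
    (descendants π φ k w).Nonempty := by
  obtain ⟨x, hx⟩ := hK.nonempty w
  obtain ⟨v, hv, -⟩ := hK.exists_mem_descendants k hx
  exact ⟨v, hv⟩

lemma exists_cell_mem (hK : SatisfiesBasicFramework π φ K ζ) (u : T) (x : X) :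
    ∃ w, treeLevel π φ w = treeLevel π φ u ∧ x ∈ K w := by
  have hx : x ∈ ⋃ w ∈ {w : T | treeLevel π φ w = 0}, K w := by
    rw [hK.partition.cover]; trivial
  simp only [mem_iUnion, exists_prop] at hx
  obtain ⟨w, hw, hxw⟩ := hx
  have hw : treeLevel π φ w = 0 := hw
  by_cases h0 : 0 ≤ treeLevel π φ u
  · obtain ⟨v, hv, hxv⟩ := hK.exists_mem_descendants (treeLevel π φ u).toNat hxw
    refine ⟨v, ?_, hxv⟩
    rw [hv.2, hw]; omega
  · refine ⟨π^[(-treeLevel π φ u).toNat] w, ?_, hK.cell_subset_iterate _ w hxw⟩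
    apply hK.tree.treeLevel_iterate_of_inhabited
    omega

lemma exists_children_bound (hK : SatisfiesBasicFramework π φ K ζ) :
    ∃ N : ℕ, 1 ≤ N ∧ ∀ k w, (descendants π φ k w).encard ≤ (N : ℕ∞) ^ k := by
  obtain ⟨N, hN⟩ := hK.children_bounded
  have hN' : ∀ w, (descendants π φ 1 w).encard ≤ ((N + 1 : ℕ) : ℕ∞) := fun w =>
    (hN w).trans (by exact_mod_cast Nat.le_succ N)
  refine ⟨N + 1, by omega, fun k => ?_⟩
  induction k with
  | zero => intro w; simp [IsRefTree.descendants_zero]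
  | succ k ih =>
    intro w
    rw [hK.tree.descendants_add, pow_succ]
    have hfin : (descendants π φ k w).Finite := by
      refine finite_of_encard_le_coe (k := (N + 1) ^ k) ?_
      exact_mod_cast ih w
    refine (encard_biUnion_le_mul hfin fun i _ => hN' i).trans ?_
    gcongr
    exact ih w

lemma descendants_finite (hK : SatisfiesBasicFramework π φ K ζ) (k : ℕ) (w : T) :
    (descendants π φ k w).Finite := by
  obtain ⟨N, -, hN⟩ := hK.exists_children_bound
  refine finite_of_encard_le_coe (k := N ^ k) ?_
  exact_mod_cast hN k w

/-- This is not a bound on `descendants`: in a rooted tree iteration may stall at `φ`, so the level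
of `u` need not be `n - q`. Away from `φ` every step still goes up one level, and children are
bounded. -/
lemma exists_iterate_fiber_bound (hK : SatisfiesBasicFramework π φ K ζ) :
    ∃ N : ℕ, 1 ≤ N ∧ ∀ (q : ℕ) (n : ℤ) (u : T),
      {v | treeLevel π φ v = n ∧ π^[q] v = u}.encard ≤ ((N ^ q : ℕ) : ℕ∞) := by
  obtain ⟨N, hN1, hN⟩ := hK.exists_children_bound
  refine ⟨N, hN1, fun q => ?_⟩
  induction q with
  | zero =>
    intro n u
    calc _ ≤ ({u} : Set T).encard := encard_le_encard (fun v hv => hv.2)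
      _ ≤ _ := by simp
  | succ q ih =>
    intro n u
    -- Level `0` of a rooted tree is the exception: it contains only `φ`, its own parent.
    by_cases hc : π φ = φ ∧ n = 0
    · calc _ ≤ ({φ} : Set T).encard := encard_le_encard fun v hv =>
            hK.tree.eq_ref_of_treeLevel_eq_zero hc.1 (hv.1.trans hc.2)
        _ ≤ _ := by
          rw [encard_singleton]
          exact_mod_cast Nat.one_le_pow _ _ hN1
    · have hne : ∀ v, treeLevel π φ v = n → π v ≠ v := fun v hv e => by
        have := hK.tree.eq_ref_of_isFixedPt e
        subst this
        exact hc ⟨e, by rw [← hv, IsRefTree.treeLevel_ref]⟩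
      have hsub : {v | treeLevel π φ v = n ∧ π^[q + 1] v = u} ⊆
          ⋃ v' ∈ {v' | treeLevel π φ v' = n - 1 ∧ π^[q] v' = u}, descendants π φ 1 v' := by
        rintro v ⟨h1, h2⟩
        have h3 := hK.tree.treeLevel_map (hne v h1)
        refine mem_biUnion (x := π v) ⟨by omega, by rw [← Function.iterate_succ_apply, h2]⟩
          ⟨rfl, by push_cast; omega⟩
      have hfin := finite_of_encard_le_coe (ih (n - 1) u)
      refine (encard_le_encard hsub).trans
        ((encard_biUnion_le_mul hfin fun i _ => hN 1 i).trans ?_)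
      rw [pow_one, pow_succ]
      push_cast
      gcongr
      exact_mod_cast ih (n - 1) u

lemma touch_refl (hK : SatisfiesBasicFramework π φ K ζ) (w : T) : CellTouch π φ K w w :=
  ⟨rfl, by rw [inter_self]; exact hK.nonempty w⟩

lemma touch_iterate (hK : SatisfiesBasicFramework π φ K ζ) {w v : T} (h : CellTouch π φ K w v)
    (k : ℕ) : CellTouch π φ K (π^[k] w) (π^[k] v) :=
  ⟨hK.tree.treeLevel_iterate_congr (by rw [h.1]),
    h.2.mono (inter_subset_inter (hK.cell_subset_iterate k w) (hK.cell_subset_iterate k v))⟩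

lemma touchBall_iterate (hK : SatisfiesBasicFramework π φ K ζ) {w v : T} {k : ℕ}
    (h : v ∈ touchBall π φ K k w) (p : ℕ) : π^[p] v ∈ touchBall π φ K k (π^[p] w) := by
  induction k generalizing w with
  | zero =>
    have h : v = w := h
    rw [h]; exact mem_singleton _
  | succ k ih =>
    simp only [touchBall, mem_iUnion, exists_prop] at h ⊢
    obtain ⟨u, hu, hv⟩ := h
    exact ⟨π^[p] u, hK.touch_iterate hu p, ih hv⟩

omit [MetricSpace X] in
lemma touchBall_snoc {w v u : T} {k : ℕ}
    (h : v ∈ touchBall π φ K k w) (hu : CellTouch π φ K v u) : u ∈ touchBall π φ K (k + 1) w := by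
  induction k generalizing w with
  | zero =>
    have h : v = w := h
    rw [touchBall]
    subst h
    exact mem_biUnion (show u ∈ {u | CellTouch π φ K v u} from hu) (mem_singleton _)
  | succ k ih =>
    rw [touchBall] at h ⊢
    simp only [mem_iUnion, exists_prop] at h ⊢
    obtain ⟨u', hu', hv⟩ := h
    exact ⟨u', hu', ih hv⟩

lemma touchBall_mono (hK : SatisfiesBasicFramework π φ K ζ) {w : T} {k l : ℕ} (hkl : k ≤ l) :
    touchBall π φ K k w ⊆ touchBall π φ K l w := by
  induction l, hkl using Nat.le_induction with
  | base => exact Subset.rfl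
  | succ l _ ih => exact fun v hv => touchBall_snoc (ih hv) (hK.touch_refl v)

omit [MetricSpace X] in
lemma touchBall_of_walk {w v : T} (p : (cellGraph π φ K).Walk w v) :
    v ∈ touchBall π φ K p.length w := by
  induction p with
  | nil => exact mem_singleton _
  | cons h p ih =>
    rw [SimpleGraph.Walk.length_cons, touchBall]
    exact mem_biUnion (show _ ∈ {v | CellTouch π φ K _ v} from ⟨h.1, h.2.2⟩) ih

lemma touchBall_of_edist_le (hK : SatisfiesBasicFramework π φ K ζ) {w v : T} {M : ℕ}
    (h : (cellGraph π φ K).edist w v ≤ M) : v ∈ touchBall π φ K M w := by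
  obtain ⟨p, hp⟩ := SimpleGraph.exists_walk_of_edist_ne_top
    (ne_top_of_le_ne_top (ENat.natCast_ne_top M) h)
  rw [← hp] at h
  exact hK.touchBall_mono (by exact_mod_cast h) (touchBall_of_walk p)

lemma exists_touchBall_bound (hK : SatisfiesBasicFramework π φ K ζ) :
    ∃ L : ℕ, ∀ k w, (touchBall π φ K k w).encard ≤ ((L ^ k : ℕ) : ℕ∞) := by
  obtain ⟨L, hL⟩ := hK.neighbors_bounded
  have h1 : ∀ w, {v | CellTouch π φ K w v}.encard ≤ ((L + 1 : ℕ) : ℕ∞) := fun w => by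
    have : {v | CellTouch π φ K w v} ⊆ insert w ((cellGraph π φ K).neighborSet w) := by
      rintro v ⟨h1, h2⟩
      by_cases e : w = v
      · exact Or.inl e.symm
      · exact Or.inr ⟨h1, e, h2⟩
    refine (encard_le_encard this).trans ((encard_insert_le _ _).trans ?_)
    push_cast
    gcongr
    exact hL w
  refine ⟨L + 1, fun k => ?_⟩
  induction k with
  | zero => intro w; simp [touchBall]
  | succ k ih =>
    intro w
    rw [touchBall, pow_succ']
    refine (encard_biUnion_le_mul (finite_of_encard_le_coe (h1 w)) fun i _ => ih i).trans ?_
    push_cast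
    gcongr
    exact_mod_cast h1 w

/-- Every cell is close to boundedly many cells. -/
lemma exists_close_bound (hK : SatisfiesBasicFramework π φ K ζ) {H : ℝ} (hH : 0 ≤ H) :
    ∃ L : ℕ, ∀ w, {v | CellClose π φ K ζ H w v}.encard ≤ (L : ℕ∞) := by
  obtain ⟨N, hN1, hN⟩ := hK.exists_iterate_fiber_bound
  obtain ⟨L, hL⟩ := hK.exists_touchBall_bound
  obtain ⟨M, -, c, C, hc, hC, hd⟩ := hK.dist_comparable
  -- With this `q`, points at distance at most `H ζ ^ [w]` are linked by a chain of length `M` on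
  -- some level `≥ [w] - q`, since their distance is at least `c ζ ^ n` for the last linked level
  -- `n`.
  obtain ⟨q, hq⟩ : ∃ q : ℕ, H * ζ ^ q < c := by
    obtain ⟨q, hq⟩ := exists_pow_lt_of_lt_one (show 0 < c / (H + 1) by positivity) hK.ratio_lt_one
    refine ⟨q, ?_⟩
    rw [lt_div_iff₀ (by positivity)] at hq
    have := pow_pos hK.ratio_pos q
    nlinarith
  have key : ∀ w v, CellClose π φ K ζ H w v →
      π^[q] v ∈ touchBall π φ K (M + 1 + 1) (π^[q] w) := by
    rintro w v ⟨hlev, x, hx, y, hy, hxy⟩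
    by_cases e : x = y
    · subst e
      refine hK.touchBall_mono (k := 1) (by omega) ?_
      exact touchBall_snoc (mem_singleton _) (hK.touch_iterate ⟨hlev, x, hx, hy⟩ q)
    · obtain ⟨n, ⟨⟨w', v', hw', hv', hxw', hyv', hedist⟩, -⟩, hn, -⟩ := hd x y e
      have hle : treeLevel π φ w - q ≤ n := by
        by_contra hcon
        have h1 : ζ ^ treeLevel π φ w ≤ ζ ^ (n + q) :=
          zpow_le_zpow_right_of_le_one₀ hK.ratio_pos hK.ratio_lt_one.le (by omega)
        rw [zpow_add₀ hK.ratio_pos.ne', zpow_natCast] at h1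
        have h2 : c * ζ ^ n ≤ H * (ζ ^ n * ζ ^ q) := (hn.trans hxy).trans (by gcongr)
        have h3 := hK.zpow_pos n
        nlinarith
      -- Lift the chain from level `n` to the level of `π^[q] w`. Two more links, through the common
      -- points `x` and `y`, join its ends to the ancestors of `w` and `v`: hence `M + 1 + 1`.
      obtain ⟨p, hp⟩ : ∃ p : ℕ, n - p = treeLevel π φ w - q :=
        ⟨(n - (treeLevel π φ w - q)).toNat, by omega⟩
      have t1 : CellTouch π φ K (π^[q] w) (π^[p] w') :=
        ⟨hK.tree.treeLevel_iterate_congr (by omega), x, hK.cell_subset_iterate q w hx,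
          hK.cell_subset_iterate p w' hxw'⟩
      have t2 : CellTouch π φ K (π^[p] v') (π^[q] v) :=
        ⟨hK.tree.treeLevel_iterate_congr (by omega), y, hK.cell_subset_iterate p v' hyv',
          hK.cell_subset_iterate q v hy⟩
      refine touchBall_snoc ?_ t2
      rw [touchBall]
      exact mem_biUnion (show _ ∈ {u | CellTouch π φ K (π^[q] w) u} from t1)
        (hK.touchBall_iterate (hK.touchBall_of_edist_le hedist) p)
  refine ⟨L ^ (M + 1 + 1) * N ^ q, fun w => ?_⟩
  have hsub : {v | CellClose π φ K ζ H w v} ⊆ ⋃ u ∈ touchBall π φ K (M + 1 + 1) (π^[q] w),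
      {v | treeLevel π φ v = treeLevel π φ w ∧ π^[q] v = u} := fun v hv =>
    mem_biUnion (key w v hv) ⟨hv.1.symm, rfl⟩
  refine (encard_le_encard hsub).trans ((encard_biUnion_le_mul
    (finite_of_encard_le_coe (hL _ _)) fun u _ => hN q _ u).trans ?_)
  rw [Nat.cast_mul]
  gcongr
  exact hL _ _

lemma exists_diam_bound (hK : SatisfiesBasicFramework π φ K ζ) :
    ∃ C : ℝ, 0 < C ∧ ∀ w, ∀ x ∈ K w, ∀ y ∈ K w, dist x y ≤ C * ζ ^ treeLevel π φ w := by
  obtain ⟨c, C, hc, hC, h⟩ := hK.diam_comparable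
  exact ⟨C, hC, fun w x hx y hy =>
    (Metric.dist_le_diam_of_mem (hK.partition.isCompact w).isBounded hx hy).trans (h w).2⟩

/-- A closed ball is covered by finitely many compact cells of level `0`. Properness supplies the
cutoff functions and the Riesz–Markov theorem used for the limit measure. -/
lemma properSpace (hK : SatisfiesBasicFramework π φ K ζ) : ProperSpace X := by
  refine ProperSpace.of_isCompact_closedBall_of_le 0 fun x R hR => ?_
  obtain ⟨L, hL⟩ := hK.exists_close_bound hR
  obtain ⟨w, hw, hxw⟩ := hK.exists_cell_mem φ x
  have hfin := finite_of_encard_le_coe (hL w)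
  have hcomp := hfin.isCompact_biUnion fun v _ => hK.partition.isCompact v
  refine hcomp.of_isClosed_subset Metric.isClosed_closedBall fun y hy => ?_
  obtain ⟨v, hv, hyv⟩ := hK.exists_cell_mem φ y
  refine mem_biUnion (show v ∈ {v | CellClose π φ K ζ R w v} from
    ⟨by omega, x, hxw, y, hyv, ?_⟩) hyv
  rw [hw, IsRefTree.treeLevel_ref, zpow_zero, mul_one, dist_comm]
  exact hy

end SatisfiesBasicFramework

end Cells

/-! ### Submultiplicativity and the growth rate `NStar`. -/

section Growth

variable {X T : Type*} [MetricSpace X] {π : T → T} {φ : T} {K : T → Set X} {ζ : ℝ}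

/-- The maximal number of descendants of the `k`-th generation. -/
noncomputable def maxDescendants (π : T → T) (φ : T) (k : ℕ) : ℕ∞ :=
  ⨆ w, (descendants π φ k w).encard

lemma NStar_eq : NStar π φ =
    limsup (fun k : ℕ => (maxDescendants π φ k : ℝ≥0∞) ^ (1 / (k : ℝ))) atTop := rfl

lemma encard_le_maxDescendants (k : ℕ) (w : T) :
    (descendants π φ k w).encard ≤ maxDescendants π φ k :=
  le_iSup (fun w => (descendants π φ k w).encard) w

namespace SatisfiesBasicFramework

lemma one_le_maxDescendants (hK : SatisfiesBasicFramework π φ K ζ) (k : ℕ) :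
    1 ≤ maxDescendants π φ k :=
  (one_le_encard_iff_nonempty.2 (hK.descendants_nonempty k φ)).trans (encard_le_maxDescendants k φ)

lemma maxDescendants_add_le (hK : SatisfiesBasicFramework π φ K ζ) (k l : ℕ) :
    maxDescendants π φ (k + l) ≤ maxDescendants π φ k * maxDescendants π φ l := by
  refine iSup_le fun w => ?_
  rw [hK.tree.descendants_add]
  refine (encard_biUnion_le_mul (hK.descendants_finite k w)
    fun i _ => encard_le_maxDescendants l i).trans ?_
  gcongr
  exact encard_le_maxDescendants k w

lemma exists_maxDescendants_le (hK : SatisfiesBasicFramework π φ K ζ) :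
    ∃ N : ℕ, 1 ≤ N ∧ ∀ k, maxDescendants π φ k ≤ (N : ℕ∞) ^ k := by
  obtain ⟨N, h1, hN⟩ := hK.exists_children_bound
  exact ⟨N, h1, fun k => iSup_le (hN k)⟩

lemma maxDescendants_mul_le (hK : SatisfiesBasicFramework π φ K ζ) (j i : ℕ) :
    maxDescendants π φ (j * i) ≤ maxDescendants π φ j ^ i := by
  induction i with
  | zero =>
    refine iSup_le fun w => ?_
    simp [IsRefTree.descendants_zero]
  | succ i ih =>
    rw [mul_add_one, pow_succ]
    exact (hK.maxDescendants_add_le _ _).trans (by gcongr)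

/-- Fekete's argument: in `k = j * (k / j) + k % j` the remainder contributes at most the factor `N
^ j`, whose `k`-th root tends to `1`. -/
lemma NStar_le_rpow (hK : SatisfiesBasicFramework π φ K ζ) {j : ℕ} (hj : 0 < j) :
    NStar π φ ≤ (maxDescendants π φ j : ℝ≥0∞) ^ (1 / (j : ℝ)) := by
  obtain ⟨N, hN1, hN⟩ := hK.exists_maxDescendants_le
  set a : ℝ≥0∞ := (maxDescendants π φ j : ℝ≥0∞) ^ (1 / (j : ℝ)) with ha
  have hone : (1 : ℝ≥0∞) ≤ maxDescendants π φ j := by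
    exact_mod_cast hK.one_le_maxDescendants j
  have ha1 : 1 ≤ a := ENNReal.one_le_rpow hone (by positivity)
  have haj : (maxDescendants π φ j : ℝ≥0∞) = a ^ j := by
    rw [ha, ← ENNReal.rpow_natCast, ← ENNReal.rpow_mul, one_div,
      inv_mul_cancel₀ (by positivity), ENNReal.rpow_one]
  have hb : ∀ k, (maxDescendants π φ k : ℝ≥0∞) ≤ a ^ k * (N : ℝ≥0∞) ^ j := by
    intro k
    have h1 : maxDescendants π φ k ≤ maxDescendants π φ j ^ (k / j) * (N : ℕ∞) ^ j := by
      conv_lhs => rw [← Nat.div_add_mod k j]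
      refine (hK.maxDescendants_add_le _ _).trans ?_
      gcongr
      · exact hK.maxDescendants_mul_le _ _
      · refine (hN _).trans (pow_le_pow_right₀ (by exact_mod_cast hN1) (Nat.mod_lt _ hj).le)
    calc (maxDescendants π φ k : ℝ≥0∞)
        ≤ ((maxDescendants π φ j ^ (k / j) * (N : ℕ∞) ^ j : ℕ∞) : ℝ≥0∞) := by exact_mod_cast h1
      _ = (a ^ j) ^ (k / j) * (N : ℝ≥0∞) ^ j := by rw [← haj]; push_cast; rfl
      _ ≤ _ := by
        rw [← pow_mul]
        gcongr
        exact Nat.mul_div_le k j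
  have hlim : Tendsto (fun k : ℕ => a * ((N : ℝ≥0∞) ^ j) ^ (1 / (k : ℝ))) atTop (𝓝 a) := by
    have h0 : Tendsto (fun k : ℕ => 1 / (k : ℝ)) atTop (𝓝 0) := tendsto_one_div_atTop_nhds_zero_nat
    have h1 : Tendsto (fun k : ℕ => ((N : ℝ≥0∞) ^ j) ^ (1 / (k : ℝ))) atTop (𝓝 1) := by
      have hc : ((N : ℝ≥0∞) ^ j) = (((N : ℝ≥0) ^ j : ℝ≥0) : ℝ≥0∞) := by push_cast; rfl
      have hpos : ((N : ℝ≥0) ^ j) ≠ 0 := by positivity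
      have h2 : Tendsto (fun k : ℕ => ((N : ℝ≥0) ^ j) ^ (1 / (k : ℝ))) atTop (𝓝 1) := by
        have h3 : ContinuousAt (fun p : ℝ≥0 × ℝ => p.1 ^ p.2) ((N : ℝ≥0) ^ j, 0) :=
          NNReal.continuousAt_rpow (Or.inl hpos)
        have h4 := h3.tendsto.comp (tendsto_const_nhds (x := (N : ℝ≥0) ^ j) |>.prodMk_nhds h0)
        simpa [Function.comp_def] using h4
      have h5 := ENNReal.tendsto_coe.2 h2
      rw [hc]
      refine h5.congr fun k => ?_
      rw [ENNReal.coe_rpow_of_ne_zero hpos]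
    simpa using ENNReal.Tendsto.const_mul h1 (Or.inl one_ne_zero)
  rw [NStar_eq, ← hlim.limsup_eq]
  refine limsup_le_limsup ?_
  filter_upwards [eventually_gt_atTop 0] with k hk
  calc (maxDescendants π φ k : ℝ≥0∞) ^ (1 / (k : ℝ))
      ≤ (a ^ k * (N : ℝ≥0∞) ^ j) ^ (1 / (k : ℝ)) := ENNReal.rpow_le_rpow (hb k) (by positivity)
    _ = a * ((N : ℝ≥0∞) ^ j) ^ (1 / (k : ℝ)) := by
      rw [ENNReal.mul_rpow_of_nonneg _ _ (by positivity), ← ENNReal.rpow_natCast a,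
        ← ENNReal.rpow_mul, mul_one_div_cancel (by positivity), ENNReal.rpow_one]

lemma NStar_pow_le (hK : SatisfiesBasicFramework π φ K ζ) (k : ℕ) :
    NStar π φ ^ k ≤ maxDescendants π φ k := by
  rcases Nat.eq_zero_or_pos k with rfl | hk
  · rw [pow_zero]; exact_mod_cast hK.one_le_maxDescendants 0
  · calc NStar π φ ^ k ≤ ((maxDescendants π φ k : ℝ≥0∞) ^ (1 / (k : ℝ))) ^ k := by
          gcongr; exact hK.NStar_le_rpow hk
      _ = _ := by
          rw [← ENNReal.rpow_natCast, ← ENNReal.rpow_mul, one_div,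
            inv_mul_cancel₀ (by positivity), ENNReal.rpow_one]

lemma one_le_NStar (hK : SatisfiesBasicFramework π φ K ζ) : 1 ≤ NStar π φ := by
  rw [NStar_eq]
  refine le_limsup_of_frequently_le (Frequently.of_forall fun k => ?_) (by isBoundedDefault)
  have h1 : (1 : ℝ≥0∞) ≤ maxDescendants π φ k := by
    exact_mod_cast hK.one_le_maxDescendants k
  simpa using ENNReal.rpow_le_rpow h1 (show 0 ≤ 1 / (k : ℝ) by positivity)

lemma NStar_ne_top (hK : SatisfiesBasicFramework π φ K ζ) : NStar π φ ≠ ∞ := by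
  obtain ⟨N, -, hN⟩ := hK.exists_maxDescendants_le
  have h1 := hK.NStar_pow_le 1
  rw [pow_one] at h1
  have h2 : (maxDescendants π φ 1 : ℝ≥0∞) ≤ ((N : ℕ∞) ^ 1 : ℕ∞) := by exact_mod_cast hN 1
  refine ne_top_of_le_ne_top ?_ (h1.trans h2)
  simp

/-- For large `k`, the number of descendants of generation `k` is well below `(N_* + ε) ^ k`. -/
lemma eventually_maxDescendants_le (hK : SatisfiesBasicFramework π φ K ζ) {ε : ℝ≥0} (hε : 0 < ε) :
    ∀ᶠ k : ℕ in atTop, 2 * (maxDescendants π φ k : ℝ≥0∞) ≤ (NStar π φ + ε) ^ k := by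
  obtain ⟨s, hs⟩ : ∃ s : ℝ≥0, (s : ℝ≥0∞) = NStar π φ := ⟨_, ENNReal.coe_toNNReal hK.NStar_ne_top⟩
  have hs1 : 1 ≤ s := by
    have := hK.one_le_NStar
    rw [← hs] at this
    exact_mod_cast this
  have hlt : NStar π φ < (s + ε / 2 : ℝ≥0) := by
    rw [← hs]
    exact_mod_cast lt_add_of_pos_right s (half_pos hε)
  have h1 : ∀ᶠ k : ℕ in atTop,
      (maxDescendants π φ k : ℝ≥0∞) ^ (1 / (k : ℝ)) < (s + ε / 2 : ℝ≥0) := by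
    rw [NStar_eq] at hlt
    exact eventually_lt_of_limsup_lt hlt
  -- The gap between `ε / 2` and `ε` grows geometrically and absorbs the factor `2`, which will pay
  -- for the diffusion.
  have hr : 1 < (s + ε) / (s + ε / 2) := by
    rw [one_lt_div (by positivity)]
    have := half_lt_self hε
    gcongr
  have h2 : ∀ᶠ k : ℕ in atTop, 2 ≤ ((s + ε) / (s + ε / 2)) ^ k :=
    (tendsto_pow_atTop_atTop_of_one_lt hr).eventually_ge_atTop 2
  filter_upwards [h1, h2, eventually_gt_atTop 0] with k hk1 hk2 hk0
  have h3 : (maxDescendants π φ k : ℝ≥0∞) ≤ ((s + ε / 2 : ℝ≥0) : ℝ≥0∞) ^ k := by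
    calc (maxDescendants π φ k : ℝ≥0∞) = ((maxDescendants π φ k : ℝ≥0∞) ^ (1 / (k : ℝ))) ^ k := by
          rw [← ENNReal.rpow_natCast, ← ENNReal.rpow_mul, one_div,
            inv_mul_cancel₀ (by positivity), ENNReal.rpow_one]
      _ ≤ _ := by gcongr
  rw [div_pow, le_div_iff₀ (by positivity)] at hk2
  calc 2 * (maxDescendants π φ k : ℝ≥0∞) ≤ 2 * ((s + ε / 2 : ℝ≥0) : ℝ≥0∞) ^ k := by gcongr
    _ ≤ ((s + ε : ℝ≥0) : ℝ≥0∞) ^ k := by exact_mod_cast hk2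
    _ = _ := by rw [← hs]; push_cast; rfl

end SatisfiesBasicFramework

end Growth

/-! ### Lower bound: disjoint balls in descendants. -/

section LowerBound

variable {X T : Type*} [MetricSpace X] [MeasurableSpace X]
  {π : T → T} {φ : T} {K : T → Set X} {ζ : ℝ}

lemma IsVolumeDoubling.ball_pos {μ : Measure X} (hμ : IsVolumeDoubling μ) (x : X) {r : ℝ}
    (hr : 0 < r) : 0 < μ (Metric.ball x r) := by
  obtain ⟨C, -, h⟩ := hμ
  have := (h x (r / 2) (by positivity)).1
  rwa [mul_div_cancel₀ _ two_ne_zero] at this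

lemma IsVolumeDoubling.ball_lt_top {μ : Measure X} (hμ : IsVolumeDoubling μ) (x : X) {r : ℝ}
    (hr : 0 < r) : μ (Metric.ball x r) < ∞ := by
  obtain ⟨C, hC, h⟩ := hμ
  refine lt_of_le_of_lt ?_ (h x r hr).2.2
  exact le_mul_of_one_le_left (by positivity) (by exact_mod_cast hC.le)

lemma IsVolumeDoubling.ball_le_volumeRatioSup_mul {μ : Measure X} (hμ : IsVolumeDoubling μ)
    (hζ : 0 < ζ) (k : ℕ) (x : X) {r : ℝ} (hr : 0 < r)
    (hd : ENNReal.ofReal r < Metric.ediam (univ : Set X)) :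
    μ (Metric.ball x r) ≤ volumeRatioSup μ ζ k * μ (Metric.ball x (ζ ^ k * r)) := by
  have hpos : 0 < ζ ^ k * r := by positivity
  rw [← ENNReal.div_le_iff (hμ.ball_pos x hpos).ne' (hμ.ball_lt_top x hpos).ne]
  unfold volumeRatioSup
  exact le_iSup_of_le x (le_iSup₂_of_le r ⟨hr, hd⟩ le_rfl)

namespace SatisfiesBasicFramework

variable [BorelSpace X]

/-- By the choice of `j`, a ball of radius `r` centred anywhere in `K w` contains `K w`, while
shrinking it by `ζ ^ (k + j)` at `x v` gives the inner ball of `K v`. The inner balls lie in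
disjoint interiors, so their masses add up to at most `μ (K w)`, which is then cancelled. -/
lemma encard_descendants_le_volumeRatioSup (hK : SatisfiesBasicFramework π φ K ζ) {ξ C : ℝ}
    (hξ : 0 < ξ) (hball : ∀ w, ∃ x ∈ K w, Metric.ball x (ξ * ζ ^ treeLevel π φ w) ⊆ K w)
    (hC : ∀ w, ∀ x ∈ K w, ∀ y ∈ K w, dist x y ≤ C * ζ ^ treeLevel π φ w)
    {j : ℕ} (hj : C * ζ ^ j < ξ) {w : T}
    (hw : ENNReal.ofReal (ξ * ζ ^ (treeLevel π φ w - j)) < Metric.ediam (univ : Set X))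
    {μ : Measure X} (hμ : IsVolumeDoubling μ) (k : ℕ) :
    ((descendants π φ k w).encard : ℝ≥0∞) ≤ volumeRatioSup μ ζ (k + j) := by
  choose x hx hxK using hball
  set r : ℝ := ξ * ζ ^ (treeLevel π φ w - j) with hr
  have hr0 : 0 < r := mul_pos hξ (hK.zpow_pos _)
  have hwpos := hK.zpow_pos (treeLevel π φ w)
  have hζj := pow_pos hK.ratio_pos j
  have hCr : C * ζ ^ treeLevel π φ w < r := by
    rw [hr, zpow_sub₀ hK.ratio_pos.ne', zpow_natCast, mul_div_assoc', lt_div_iff₀ hζj]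
    nlinarith
  have hrv : ∀ v ∈ descendants π φ k w, ζ ^ (k + j) * r = ξ * ζ ^ treeLevel π φ v := by
    intro v hv
    rw [hv.2, hr, mul_left_comm, ← zpow_natCast, ← zpow_add₀ hK.ratio_pos.ne']
    congr 2
    push_cast; ring
  have hsub : ∀ v ∈ descendants π φ k w, K w ⊆ Metric.ball (x v) r := fun v hv y hy =>
    (hC w y hy _ (hK.cell_subset_of_mem_descendants hv (hx v))).trans_lt hCr
  have hμ0 : μ (K w) ≠ 0 := by
    refine ne_of_gt ((hμ.ball_pos (x w) (mul_pos hξ (hK.zpow_pos _))).trans_le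
      (measure_mono (hxK w)))
  have hμt : μ (K w) ≠ ∞ := by
    obtain ⟨v, hv⟩ := hK.descendants_nonempty k w
    exact ((measure_mono (hsub v hv)).trans_lt (hμ.ball_lt_top _ hr0)).ne
  set S := (hK.descendants_finite k w).toFinset with hS
  have hmem : ∀ v ∈ S, v ∈ descendants π φ k w := fun v hv => by simpa [hS] using hv
  have hcard : ((descendants π φ k w).encard : ℝ≥0∞) = S.card := by
    rw [(hK.descendants_finite k w).encard_eq_coe_toFinset_card]; simp [hS]
  rw [hcard]
  set B : T → Set X := fun v => Metric.ball (x v) (ξ * ζ ^ treeLevel π φ v) with hB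
  have hdisj : (S : Set T).PairwiseDisjoint B := by
    intro u hu v hv huv
    have hu' := hmem u hu
    have hv' := hmem v hv
    refine disjoint_iff_inter_eq_empty.2 (subset_empty_iff.1 ?_)
    rw [← hK.interior_disjoint u v (by rw [hu'.2, hv'.2]) huv]
    exact inter_subset_inter (interior_maximal (hxK u) Metric.isOpen_ball)
      (interior_maximal (hxK v) Metric.isOpen_ball)
  have key : (S.card : ℝ≥0∞) * μ (K w) ≤ volumeRatioSup μ ζ (k + j) * μ (K w) := by
    calc (S.card : ℝ≥0∞) * μ (K w) = ∑ v ∈ S, μ (K w) := by rw [Finset.sum_const, nsmul_eq_mul]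
      _ ≤ ∑ v ∈ S, volumeRatioSup μ ζ (k + j) * μ (B v) := by
        refine Finset.sum_le_sum fun v hv => ?_
        refine (measure_mono (hsub v (hmem v hv))).trans ?_
        refine (hμ.ball_le_volumeRatioSup_mul hK.ratio_pos (k + j) _ hr0 hw).trans ?_
        rw [hrv v (hmem v hv)]
      _ = volumeRatioSup μ ζ (k + j) * μ (⋃ v ∈ S, B v) := by
        rw [measure_biUnion_finset hdisj fun v _ => Metric.isOpen_ball.measurableSet,
          Finset.mul_sum]
      _ ≤ _ := by
        gcongr
        exact iUnion₂_subset fun v hv =>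
          (hxK v).trans (hK.cell_subset_of_mem_descendants (hmem v hv))
  exact (ENNReal.mul_le_mul_iff_left hμ0 hμt).1 key

omit [BorelSpace X] in
lemma one_le_volumeRatioSup (hK : SatisfiesBasicFramework π φ K ζ)
    {μ : Measure X} (hμ : IsVolumeDoubling μ) (k : ℕ) : 1 ≤ volumeRatioSup μ ζ k := by
  obtain ⟨x, hx, y, hy, hxy⟩ := hK.partition.nontrivial φ
  have hd : 0 < Metric.ediam (univ : Set X) := by
    refine lt_of_lt_of_le (edist_pos.2 hxy) (Metric.edist_le_ediam_of_mem (mem_univ _) (mem_univ _))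
  obtain ⟨r, hr0, hr⟩ := ENNReal.lt_iff_exists_nnreal_btwn.1 hd
  have hr0' : (0 : ℝ) < r := by exact_mod_cast hr0
  have hpos : 0 < ζ ^ k * (r : ℝ) := mul_pos (pow_pos hK.ratio_pos k) hr0'
  have h1 := hμ.ball_le_volumeRatioSup_mul hK.ratio_pos k x hr0' (by simpa using hr)
  have h2 : μ (Metric.ball x (ζ ^ k * r)) ≤ μ (Metric.ball x r) := by
    refine measure_mono (Metric.ball_subset_ball ?_)
    exact mul_le_of_le_one_left hr0'.le (pow_le_one₀ hK.ratio_pos.le hK.ratio_lt_one.le)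
  have h3 := h2.trans h1
  refine (ENNReal.mul_le_mul_iff_left (hμ.ball_pos x hpos).ne' (hμ.ball_lt_top x hpos).ne).1 ?_
  rwa [one_mul]

/-- The growth of volume ratios of doubling measures is at least that of the tree. -/
lemma exists_mul_NStar_pow_le_volumeRatioSup (hK : SatisfiesBasicFramework π φ K ζ) :
    ∃ c : ℝ≥0, 0 < c ∧ ∀ μ : Measure X, IsVolumeDoubling μ → ∀ k : ℕ,
      (c : ℝ≥0∞) * NStar π φ ^ k ≤ volumeRatioSup μ ζ k := by
  obtain ⟨N, hN1, hN⟩ := hK.exists_maxDescendants_le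
  obtain ⟨C, hC0, hC⟩ := hK.exists_diam_bound
  obtain ⟨ξ, hξ, hball⟩ := hK.inner_ball
  obtain ⟨c, _, hc, -, hcdiam⟩ := hK.diam_comparable
  obtain ⟨j, hj⟩ : ∃ j : ℕ, C * ζ ^ j < ξ := by
    obtain ⟨j, hj⟩ := exists_pow_lt_of_lt_one (show 0 < ξ / C by positivity) hK.ratio_lt_one
    exact ⟨j, by rwa [lt_div_iff₀' hC0] at hj⟩
  have hζj := pow_pos hK.ratio_pos j
  -- Near the root the radius used for a cell may exceed the diameter of the space. For descendants
  -- `J` generations below `w` it is smaller than the diameter of `K w`; skipping these generations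
  -- costs the factor `N ^ J`.
  obtain ⟨J, hJ⟩ : ∃ J : ℕ, ξ * ζ ^ J < c * ζ ^ j := by
    obtain ⟨J, hJ⟩ := exists_pow_lt_of_lt_one (show 0 < c * ζ ^ j / ξ by positivity) hK.ratio_lt_one
    exact ⟨J, by rwa [lt_div_iff₀' hξ] at hJ⟩
  have hdeep : ∀ w v, v ∈ descendants π φ J w →
      ENNReal.ofReal (ξ * ζ ^ (treeLevel π φ v - j)) < Metric.ediam (univ : Set X) := by
    intro w v hv
    have h1 : ξ * ζ ^ (treeLevel π φ v - j) < c * ζ ^ treeLevel π φ w := by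
      rw [hv.2, zpow_sub₀ hK.ratio_pos.ne', zpow_add₀ hK.ratio_pos.ne', zpow_natCast,
        zpow_natCast, mul_div_assoc', div_lt_iff₀ hζj]
      have := hK.zpow_pos (treeLevel π φ w)
      nlinarith
    have hcw : 0 < c * ζ ^ treeLevel π φ w := mul_pos hc (hK.zpow_pos _)
    calc ENNReal.ofReal (ξ * ζ ^ (treeLevel π φ v - j))
        < ENNReal.ofReal (c * ζ ^ treeLevel π φ w) := (ENNReal.ofReal_lt_ofReal_iff hcw).2 h1
      _ ≤ ENNReal.ofReal (Metric.diam (K w)) := ENNReal.ofReal_le_ofReal (hcdiam w).1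
      _ ≤ Metric.ediam (K w) := ENNReal.ofReal_toReal_le
      _ ≤ _ := Metric.ediam_mono (subset_univ _)
  have hNS : NStar π φ ≤ N := by
    have h1 := hK.NStar_pow_le 1
    rw [pow_one] at h1
    have h2 : (maxDescendants π φ 1 : ℝ≥0∞) ≤ ((N : ℕ∞) ^ 1 : ℕ∞) := by exact_mod_cast hN 1
    simpa using h1.trans h2
  have hmain : ∀ μ : Measure X, IsVolumeDoubling μ → ∀ k : ℕ,
      NStar π φ ^ k ≤ (N : ℝ≥0∞) ^ J * volumeRatioSup μ ζ (k + j) := by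
    intro μ hμ k
    have h1 : ∀ w, ((descendants π φ (J + k) w).encard : ℝ≥0∞) ≤
        (N : ℝ≥0∞) ^ J * volumeRatioSup μ ζ (k + j) := by
      intro w
      have hfin := hK.descendants_finite J w
      have h2 : ((descendants π φ (J + k) w).encard : ℝ≥0∞) ≤
          ∑ v ∈ hfin.toFinset, ((descendants π φ k v).encard : ℝ≥0∞) := by
        have h3 : (descendants π φ (J + k) w).encard ≤
            ∑ v ∈ hfin.toFinset, (descendants π φ k v).encard := by
          rw [hK.tree.descendants_add]
          refine le_trans (le_of_eq ?_)
            (Finset.set_encard_biUnion_le hfin.toFinset fun v => descendants π φ k v)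
          simp
        have h4 : ((∑ v ∈ hfin.toFinset, (descendants π φ k v).encard : ℕ∞) : ℝ≥0∞) =
            ∑ v ∈ hfin.toFinset, ((descendants π φ k v).encard : ℝ≥0∞) :=
          map_sum ENat.toENNRealRingHom _ _
        rw [← h4]
        exact_mod_cast h3
      refine h2.trans ?_
      calc ∑ v ∈ hfin.toFinset, ((descendants π φ k v).encard : ℝ≥0∞)
          ≤ ∑ v ∈ hfin.toFinset, volumeRatioSup μ ζ (k + j) :=
            Finset.sum_le_sum fun v hv => hK.encard_descendants_le_volumeRatioSup hξ hball hC hj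
              (hdeep w v (by simpa using hv)) hμ k
        _ = (hfin.toFinset.card : ℝ≥0∞) * volumeRatioSup μ ζ (k + j) := by
          rw [Finset.sum_const, nsmul_eq_mul]
        _ ≤ _ := by
          gcongr
          have h5 := (encard_le_maxDescendants J w).trans (hN J)
          rw [hfin.encard_eq_coe_toFinset_card] at h5
          exact_mod_cast h5
    calc NStar π φ ^ k ≤ NStar π φ ^ (J + k) :=
          pow_le_pow_right₀ hK.one_le_NStar (Nat.le_add_left _ _)
      _ ≤ maxDescendants π φ (J + k) := hK.NStar_pow_le _
      _ ≤ _ := by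
        unfold maxDescendants
        rw [ENat.toENNReal_iSup]
        exact iSup_le h1
  have hN0 : (0 : ℝ≥0) < (N : ℝ≥0) ^ (J + j) := by positivity
  -- `N ^ J` pays for the skipped generations and `N ^ j` for the shift from `k + j` to `k`; for `k
  -- < j` it suffices that the ratio is at least `1`.
  refine ⟨((N : ℝ≥0) ^ (J + j))⁻¹, by positivity, fun μ hμ k => ?_⟩
  have hN1' : (1 : ℝ≥0∞) ≤ N := by exact_mod_cast hN1
  rw [ENNReal.coe_inv hN0.ne', mul_comm, ← div_eq_mul_inv]
  refine ENNReal.div_le_of_le_mul' ?_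
  push_cast
  by_cases hk : j ≤ k
  · obtain ⟨i, rfl⟩ := Nat.exists_eq_add_of_le' hk
    calc NStar π φ ^ (i + j) = NStar π φ ^ i * NStar π φ ^ j := pow_add _ _ _
      _ ≤ ((N : ℝ≥0∞) ^ J * volumeRatioSup μ ζ (i + j)) * (N : ℝ≥0∞) ^ j := by
        gcongr
        exact hmain μ hμ i
      _ = _ := by ring
  · calc NStar π φ ^ k ≤ (N : ℝ≥0∞) ^ k := by gcongr
      _ ≤ (N : ℝ≥0∞) ^ (J + j) := pow_le_pow_right₀ hN1' (by omega)
      _ = (N : ℝ≥0∞) ^ (J + j) * 1 := (mul_one _).symm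
      _ ≤ _ := by
        gcongr
        exact hK.one_le_volumeRatioSup hμ k

end SatisfiesBasicFramework

end LowerBound

/-! ### One step of mass transport: equal splitting and diffusion. -/

section Transport

variable {T : Type*}

/-- The mass of a child when the mass of each cell is shared equally among its children. -/
noncomputable def childMass (par : T → T) (ch : T → Finset T) (h : T → ℝ≥0∞) (y : T) : ℝ≥0∞ :=
  h (par y) / (ch (par y)).card

/-- The equal distribution of masses among children, followed by one step of a slow diffusion in
which every cell gives the proportion `δ` of its mass to each close cell. -/
noncomputable def massTransport (par : T → T) (ch cl : T → Finset T) (δ : ℝ≥0∞) (h : T → ℝ≥0∞)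
    (y : T) : ℝ≥0∞ :=
  (1 - δ * (cl y).card) * childMass par ch h y + δ * ∑ z ∈ cl y, childMass par ch h z

/-- Cells with levels, parents, children `m` levels below and close cells, such that closeness is
inherited by the parents, even along chains of length two. -/
structure IsTransportScheme (lev : T → ℤ) (par : T → T) (ch cl : T → Finset T) (m N L : ℕ) :
    Prop where
  step_pos : 0 < m
  ch_nonempty : ∀ x, (ch x).Nonempty
  ch_card_le : ∀ x, (ch x).card ≤ N
  cl_card_le : ∀ x, (cl x).card ≤ L
  mem_cl_self : ∀ x, x ∈ cl x
  cl_symm : ∀ {x y}, y ∈ cl x → x ∈ cl y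
  lev_cl : ∀ {x y}, y ∈ cl x → lev y = lev x
  lev_par : ∀ {u y}, lev y = lev u + m → lev (par y) = lev u
  mem_ch_iff : ∀ {x y}, y ∈ ch x ↔ par y = x ∧ lev y = lev x + m
  par_mem_cl : ∀ {u y y' z}, lev y = lev u + m → y' ∈ cl y → z ∈ cl y → par z ∈ cl (par y')

namespace IsTransportScheme

variable {lev : T → ℤ} {par : T → T} {ch cl : T → Finset T} {m N L : ℕ}

lemma one_le_ch_bound [Nonempty T] (S : IsTransportScheme lev par ch cl m N L) : 1 ≤ N := by
  have x := Classical.arbitrary T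
  exact (Finset.card_pos.2 (S.ch_nonempty x)).trans_le (S.ch_card_le x)

lemma one_le_cl_bound [Nonempty T] (S : IsTransportScheme lev par ch cl m N L) : 1 ≤ L := by
  have x := Classical.arbitrary T
  exact (Finset.card_pos.2 ⟨x, S.mem_cl_self x⟩).trans_le (S.cl_card_le x)

lemma childMass_le (S : IsTransportScheme lev par ch cl m N L) (h : T → ℝ≥0∞) (y : T) :
    childMass par ch h y ≤ h (par y) := by
  refine ENNReal.div_le_of_le_mul ?_
  refine le_mul_of_one_le_right (by positivity) ?_
  exact_mod_cast Finset.card_pos.2 (S.ch_nonempty (par y))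

lemma le_mul_childMass (S : IsTransportScheme lev par ch cl m N L) (h : T → ℝ≥0∞) (y : T) :
    h (par y) ≤ N * childMass par ch h y := by
  have hc : ((ch (par y)).card : ℝ≥0∞) ≠ 0 := by
    exact_mod_cast (Finset.card_pos.2 (S.ch_nonempty (par y))).ne'
  calc h (par y) = (ch (par y)).card * childMass par ch h y :=
        (ENNReal.mul_div_cancel hc (by simp)).symm
    _ ≤ _ := by
      gcongr
      exact_mod_cast S.ch_card_le _

section

variable [Nonempty T]

lemma diffusion_mul_cancel (S : IsTransportScheme lev par ch cl m N L) :
    (4 * L * N : ℝ≥0∞)⁻¹ * (4 * L * N) = 1 := by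
  have h1 : (N : ℝ≥0∞) ≠ 0 := by exact_mod_cast (Nat.pos_of_ne_zero (by
    have := S.one_le_ch_bound; omega)).ne'
  have h2 : (L : ℝ≥0∞) ≠ 0 := by exact_mod_cast (Nat.pos_of_ne_zero (by
    have := S.one_le_cl_bound; omega)).ne'
  refine ENNReal.inv_mul_cancel (by simp [h1, h2]) ?_
  exact ENNReal.mul_ne_top (ENNReal.mul_ne_top (by simp) (by simp)) (by simp)

lemma diffusion_ne_top (S : IsTransportScheme lev par ch cl m N L) :
    (4 * L * N : ℝ≥0∞)⁻¹ ≠ ∞ := by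
  intro h
  have := S.diffusion_mul_cancel
  rw [h] at this
  rcases eq_or_ne (4 * L * N : ℝ≥0∞) 0 with h0 | h0
  · rw [h0] at this; simp at this
  · rw [ENNReal.top_mul h0] at this; simp at this

/-- At most half of the mass of a cell is given out, so the subtraction in `massTransport` is never
truncated and every cell retains half of its equal share. -/
lemma diffusion_mul_card_le (S : IsTransportScheme lev par ch cl m N L) (y : T) :
    (4 * L * N : ℝ≥0∞)⁻¹ * (cl y).card ≤ 2⁻¹ := by
  have h1 : ((cl y).card : ℝ≥0∞) ≤ (4 * L * N) * 2⁻¹ := by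
    have h2 : (2 : ℝ≥0∞) * 2⁻¹ = 1 := ENNReal.mul_inv_cancel (by simp) (by simp)
    calc ((cl y).card : ℝ≥0∞) ≤ L := by exact_mod_cast S.cl_card_le y
      _ ≤ ((2 * L * N : ℕ) : ℝ≥0∞) := by
        have := S.one_le_ch_bound
        exact_mod_cast (by nlinarith : L ≤ 2 * L * N)
      _ = (2 * L * N) * (2 * 2⁻¹) := by rw [h2]; push_cast; ring
      _ = _ := by ring
  calc _ ≤ (4 * L * N : ℝ≥0∞)⁻¹ * ((4 * L * N) * 2⁻¹) := by gcongr
    _ = _ := by rw [← mul_assoc, S.diffusion_mul_cancel, one_mul]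

lemma half_le_one_sub (S : IsTransportScheme lev par ch cl m N L) (y : T) :
    2⁻¹ ≤ 1 - (4 * L * N : ℝ≥0∞)⁻¹ * (cl y).card := by
  refine ENNReal.le_sub_of_add_le_right
    (ne_top_of_le_ne_top (by simp) (S.diffusion_mul_card_le y)) ?_
  calc _ ≤ (2⁻¹ : ℝ≥0∞) + 2⁻¹ := by gcongr; exact S.diffusion_mul_card_le y
    _ = 1 := ENNReal.inv_two_add_inv_two

lemma childMass_le_two_mul (S : IsTransportScheme lev par ch cl m N L) (h : T → ℝ≥0∞) (y : T) :
    childMass par ch h y ≤ 2 * massTransport par ch cl (4 * L * N : ℝ≥0∞)⁻¹ h y := by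
  have h2 : (2 : ℝ≥0∞) * 2⁻¹ = 1 := ENNReal.mul_inv_cancel (by simp) (by simp)
  calc childMass par ch h y = 2 * (2⁻¹ * childMass par ch h y) := by rw [← mul_assoc, h2, one_mul]
    _ ≤ 2 * ((1 - (4 * L * N : ℝ≥0∞)⁻¹ * (cl y).card) * childMass par ch h y) := by
      gcongr; exact S.half_le_one_sub y
    _ ≤ _ := by
      gcongr
      exact le_self_add

/-- A child keeps at least the fraction `1 / (2 * N)` of the mass of its parent. -/
lemma par_le_massTransport (S : IsTransportScheme lev par ch cl m N L) (h : T → ℝ≥0∞) (y : T) :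
    h (par y) ≤ (2 * N) * massTransport par ch cl (4 * L * N : ℝ≥0∞)⁻¹ h y := by
  calc h (par y) ≤ N * childMass par ch h y := S.le_mul_childMass h y
    _ ≤ N * (2 * massTransport par ch cl (4 * L * N : ℝ≥0∞)⁻¹ h y) := by
      gcongr; exact S.childMass_le_two_mul h y
    _ = _ := by ring

omit [Nonempty T] in
lemma massTransport_le_of_bound (S : IsTransportScheme lev par ch cl m N L) {h : T → ℝ≥0∞}
    {y : T} {b : ℝ≥0∞} (hb : ∀ z ∈ cl y, childMass par ch h z ≤ b) :
    massTransport par ch cl (4 * L * N : ℝ≥0∞)⁻¹ h y ≤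
      childMass par ch h y + (4 * L * N : ℝ≥0∞)⁻¹ * (L * b) := by
  unfold massTransport
  gcongr
  · exact mul_le_of_le_one_left (by positivity) tsub_le_self
  · calc ∑ z ∈ cl y, childMass par ch h z ≤ ∑ z ∈ cl y, b := Finset.sum_le_sum hb
      _ = (cl y).card * b := by rw [Finset.sum_const, nsmul_eq_mul]
      _ ≤ _ := by gcongr; exact_mod_cast S.cl_card_le y

/-- The transport preserves the comparability of the masses of close cells. -/
lemma massTransport_le_mul (S : IsTransportScheme lev par ch cl m N L) {h : T → ℝ≥0∞} {u : T}
    (hcomp : ∀ w v, lev w = lev u → v ∈ cl w → h w ≤ (8 * L * N) * h v) {y y' : T}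
    (hy : lev y = lev u + m) (hy' : y' ∈ cl y) :
    massTransport par ch cl (4 * L * N : ℝ≥0∞)⁻¹ h y ≤
      (8 * L * N) * massTransport par ch cl (4 * L * N : ℝ≥0∞)⁻¹ h y' := by
  set δ := (4 * L * N : ℝ≥0∞)⁻¹ with hδ
  set a := massTransport par ch cl δ h y' with ha
  have h1 : δ * childMass par ch h y ≤ a := by
    have : childMass par ch h y ≤ ∑ z ∈ cl y', childMass par ch h z :=
      Finset.single_le_sum (f := childMass par ch h) (fun _ _ => by positivity) (S.cl_symm hy')
    calc δ * childMass par ch h y ≤ δ * ∑ z ∈ cl y', childMass par ch h z := by gcongr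
      _ ≤ a := le_add_self
  have h2 : childMass par ch h y ≤ (4 * L * N) * a := by
    calc childMass par ch h y = (4 * L * N) * (δ * childMass par ch h y) := by
          rw [← mul_assoc, mul_comm _ δ, S.diffusion_mul_cancel, one_mul]
      _ ≤ _ := by gcongr
  -- `z` and `y'` are both close to `y`, so their parents are close and the comparison on the
  -- parents' level applies. This is the use of chains of length two.
  have h3 : ∀ z ∈ cl y, childMass par ch h z ≤ (8 * L * N) * (N * (2 * a)) := by
    intro z hz
    calc childMass par ch h z ≤ h (par z) := S.childMass_le h z
      _ ≤ (8 * L * N) * h (par y') := by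
        refine hcomp _ _ (S.lev_par ((S.lev_cl hz).trans hy)) ?_
        exact S.cl_symm (S.par_mem_cl hy hy' hz)
      _ ≤ (8 * L * N) * (N * (2 * a)) := by
        gcongr
        refine (S.le_mul_childMass h y').trans ?_
        gcongr
        exact S.childMass_le_two_mul h y'
  calc massTransport par ch cl δ h y
      ≤ childMass par ch h y + δ * (L * ((8 * L * N) * (N * (2 * a)))) :=
        S.massTransport_le_of_bound h3
    -- The share of `y` itself and the mass it receives are each at most `4 * L * N * a`, so the
    -- constant `8 * L * N` is reproduced.
    _ = childMass par ch h y + (δ * (4 * L * N)) * ((4 * L * N) * a) := by ring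
    _ ≤ (4 * L * N) * a + 1 * ((4 * L * N) * a) := by
      rw [S.diffusion_mul_cancel]; gcongr
    _ = _ := by ring

/-- A child gets at most a fixed multiple of the mass of its parent. -/
lemma massTransport_le_mul_par (S : IsTransportScheme lev par ch cl m N L) {h : T → ℝ≥0∞} {u : T}
    (hcomp : ∀ w v, lev w = lev u → v ∈ cl w → h w ≤ (8 * L * N) * h v) {y : T}
    (hy : lev y = lev u + m) :
    massTransport par ch cl (4 * L * N : ℝ≥0∞)⁻¹ h y ≤ (1 + 2 * L) * h (par y) := by
  have h3 : ∀ z ∈ cl y, childMass par ch h z ≤ (8 * L * N) * h (par y) := fun z hz =>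
    (S.childMass_le h z).trans (hcomp _ _ (S.lev_par ((S.lev_cl hz).trans hy))
      (S.cl_symm (S.par_mem_cl hy (S.mem_cl_self y) hz)))
  refine (S.massTransport_le_of_bound h3).trans ?_
  calc _ = childMass par ch h y +
        ((4 * L * N : ℝ≥0∞)⁻¹ * (4 * L * N)) * (2 * L * h (par y)) := by ring
    _ ≤ h (par y) + 1 * (2 * L * h (par y)) := by
      rw [S.diffusion_mul_cancel]; gcongr; exact S.childMass_le h y
    _ = _ := by ring

lemma massTransport_ne_zero (S : IsTransportScheme lev par ch cl m N L) {h : T → ℝ≥0∞}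
    (h0 : ∀ x, h x ≠ 0) (y : T) : massTransport par ch cl (4 * L * N : ℝ≥0∞)⁻¹ h y ≠ 0 := by
  intro e
  have := S.par_le_massTransport h y
  rw [e, mul_zero] at this
  exact h0 _ (le_zero_iff.1 this)

lemma massTransport_ne_top (S : IsTransportScheme lev par ch cl m N L) {h : T → ℝ≥0∞}
    (h0 : ∀ x, h x ≠ ∞) (y : T) : massTransport par ch cl (4 * L * N : ℝ≥0∞)⁻¹ h y ≠ ∞ := by
  have hc : ∀ z, childMass par ch h z ≠ ∞ := fun z =>
    ne_top_of_le_ne_top (h0 _) (S.childMass_le h z)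
  refine ENNReal.add_ne_top.2 ⟨ENNReal.mul_ne_top ?_ (hc y), ENNReal.mul_ne_top S.diffusion_ne_top ?_⟩
  · exact ne_top_of_le_ne_top ENNReal.one_ne_top tsub_le_self
  · exact (ENNReal.sum_lt_top.2 fun z _ => (hc z).lt_top).ne

omit [Nonempty T] in
/-- Integration of a test function against transported masses. -/
lemma tsum_mul_massTransport (S : IsTransportScheme lev par ch cl m N L) (h : T → ℝ≥0∞) {u : T}
    (δ : ℝ≥0∞) (a : T → ℝ≥0∞) (ha : ∀ y, a y ≠ 0 → lev y = lev u + m) :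
    ∑' y, a y * massTransport par ch cl δ h y = ∑' x, h x *
      ((∑ y ∈ ch x, (a y * (1 - δ * (cl y).card) + δ * ∑ z ∈ cl y, a z)) / (ch x).card) := by
  classical
  set g := childMass par ch h with hg
  have e1 : ∀ y, a y * massTransport par ch cl δ h y = a y * (1 - δ * (cl y).card) * g y +
      δ * ∑' z, if z ∈ cl y then a y * g z else 0 := by
    intro y
    have : ∑' z, (if z ∈ cl y then a y * g z else 0) = a y * ∑ z ∈ cl y, g z := by
      rw [tsum_eq_sum (s := cl y) (fun z hz => by simp [hz]), Finset.mul_sum]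
      exact Finset.sum_congr rfl fun z hz => by simp [hz]
    rw [this, massTransport]; ring
  have e2 : ∑' y, ∑' z, (if z ∈ cl y then a y * g z else 0) = ∑' z, (∑ y ∈ cl z, a y) * g z := by
    rw [ENNReal.tsum_comm]
    refine tsum_congr fun z => ?_
    rw [tsum_eq_sum (s := cl z) (fun y hy => by rw [if_neg fun hz => hy (S.cl_symm hz)]),
      Finset.sum_mul]
    exact Finset.sum_congr rfl fun y hy => by rw [if_pos (S.cl_symm hy)]
  set b : T → ℝ≥0∞ := fun y => a y * (1 - δ * (cl y).card) + δ * ∑ z ∈ cl y, a z with hb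
  have e3 : ∑' y, a y * massTransport par ch cl δ h y = ∑' y, b y * g y := by
    rw [tsum_congr e1, ENNReal.tsum_add, ENNReal.tsum_mul_left, e2, ← ENNReal.tsum_mul_left,
      ← ENNReal.tsum_add]
    exact tsum_congr fun y => by simp only [hb]; ring
  have hb0 : ∀ y, lev y ≠ lev u + m → b y = 0 := by
    intro y hy
    have h1 : ∀ z ∈ cl y, a z = 0 := fun z hz => by
      by_contra hne
      exact hy ((S.lev_cl hz).symm.trans (ha z hne))
    simp only [hb]
    rw [h1 y (S.mem_cl_self y), Finset.sum_eq_zero h1]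
    simp
  have e4 : ∀ x, h x * ((∑ y ∈ ch x, b y) / (ch x).card) =
      ∑' y, if y ∈ ch x then h x / (ch x).card * b y else 0 := by
    intro x
    rw [tsum_eq_sum (s := ch x) (fun z hz => by simp [hz]),
      Finset.sum_congr rfl (fun y hy => if_pos hy), ← Finset.mul_sum, div_eq_mul_inv,
      div_eq_mul_inv]
    ring
  rw [e3, tsum_congr e4, ENNReal.tsum_comm]
  refine tsum_congr fun y => ?_
  by_cases hy : lev y = lev u + m
  · rw [tsum_eq_single (par y)]
    · rw [if_pos (S.mem_ch_iff.2 ⟨rfl, by rw [S.lev_par hy, hy]⟩), hg, childMass, mul_comm]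
    · intro x hx
      rw [if_neg fun hm => hx (S.mem_ch_iff.1 hm).1.symm]
  · simp [hb0 y hy]

/-- The mass of `U` is transported to the cells close to the children of the cells in `U`. -/
lemma tsum_indicator_le_massTransport (S : IsTransportScheme lev par ch cl m N L)
    (h : T → ℝ≥0∞) {u : T} {U U' : Set T} (hU' : ∀ y ∈ U', lev y = lev u + m)
    (hUU' : ∀ x ∈ U, ∀ y ∈ ch x, ∀ z ∈ cl y, z ∈ U') :
    ∑' x, U.indicator h x ≤
      ∑' y, U'.indicator (massTransport par ch cl (4 * L * N : ℝ≥0∞)⁻¹ h) y := by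
  classical
  have e : ∀ y, U'.indicator (massTransport par ch cl (4 * L * N : ℝ≥0∞)⁻¹ h) y =
      U'.indicator 1 y * massTransport par ch cl (4 * L * N : ℝ≥0∞)⁻¹ h y := by
    intro y; by_cases hy : y ∈ U' <;> simp [hy]
  rw [tsum_congr e, S.tsum_mul_massTransport h (u := u)]
  · refine ENNReal.tsum_le_tsum fun x => ?_
    by_cases hx : x ∈ U
    · rw [indicator_of_mem hx]
      refine le_mul_of_one_le_right (by positivity) (le_of_eq ?_)
      -- The dual test function equals `1` on `U`, because all mass coming from `U` lands in `U'`.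
      have h1 : ∀ y ∈ ch x, U'.indicator (1 : T → ℝ≥0∞) y *
          (1 - (4 * L * N : ℝ≥0∞)⁻¹ * (cl y).card) +
          (4 * L * N : ℝ≥0∞)⁻¹ * ∑ z ∈ cl y, U'.indicator (1 : T → ℝ≥0∞) z = 1 := by
        intro y hy
        have h2 : ∀ z ∈ cl y, U'.indicator (1 : T → ℝ≥0∞) z = 1 := fun z hz => by
          simp [hUU' x hx y hy z hz]
        rw [h2 y (S.mem_cl_self y), Finset.sum_congr rfl h2]
        simp only [one_mul, Finset.sum_const, nsmul_eq_mul, mul_one]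
        refine tsub_add_cancel_of_le ((S.diffusion_mul_card_le y).trans ?_)
        simp
      rw [Finset.sum_congr rfl h1, Finset.sum_const, nsmul_eq_mul, mul_one]
      refine (ENNReal.div_self ?_ (by simp)).symm
      exact_mod_cast (Finset.card_pos.2 (S.ch_nonempty x)).ne'
    · simp [hx]
  · intro y hy
    exact hU' y (by by_contra hne; simp [hne] at hy)

/-- The mass of `U'` comes from the parents of the cells close to the cells in `U'`. -/
lemma massTransport_tsum_indicator_le (S : IsTransportScheme lev par ch cl m N L)
    (h : T → ℝ≥0∞) {u : T} {U U' : Set T} (hU' : ∀ y ∈ U', lev y = lev u + m)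
    (hUU' : ∀ y ∈ U', ∀ z ∈ cl y, par z ∈ U) :
    ∑' y, U'.indicator (massTransport par ch cl (4 * L * N : ℝ≥0∞)⁻¹ h) y ≤
      ∑' x, U.indicator h x := by
  classical
  have e : ∀ y, U'.indicator (massTransport par ch cl (4 * L * N : ℝ≥0∞)⁻¹ h) y =
      U'.indicator 1 y * massTransport par ch cl (4 * L * N : ℝ≥0∞)⁻¹ h y := by
    intro y; by_cases hy : y ∈ U' <;> simp [hy]
  rw [tsum_congr e, S.tsum_mul_massTransport h (u := u)]
  · refine ENNReal.tsum_le_tsum fun x => ?_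
    by_cases hx : x ∈ U
    · rw [indicator_of_mem hx]
      refine mul_le_of_le_one_right (by positivity) ?_
      have hone : ∀ z, U'.indicator (1 : T → ℝ≥0∞) z ≤ 1 := fun z =>
        indicator_le_self' (fun _ _ => zero_le_one) z
      have h1 : ∀ y ∈ ch x, U'.indicator (1 : T → ℝ≥0∞) y *
          (1 - (4 * L * N : ℝ≥0∞)⁻¹ * (cl y).card) +
          (4 * L * N : ℝ≥0∞)⁻¹ * ∑ z ∈ cl y, U'.indicator (1 : T → ℝ≥0∞) z ≤ 1 := by
        intro y hy
        calc _ ≤ 1 * (1 - (4 * L * N : ℝ≥0∞)⁻¹ * (cl y).card) +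
              (4 * L * N : ℝ≥0∞)⁻¹ * ∑ z ∈ cl y, 1 := by
              gcongr
              · exact hone y
              · exact hone _
          _ = 1 := by
            simp only [one_mul, Finset.sum_const, nsmul_eq_mul, mul_one]
            refine tsub_add_cancel_of_le ((S.diffusion_mul_card_le y).trans ?_)
            simp
      refine ENNReal.div_le_of_le_mul ((Finset.sum_le_sum h1).trans ?_)
      simp
    -- Outside `U` the dual test function vanishes: no child has a close cell in `U'`.
    · have h1 : ∀ y ∈ ch x, ∀ z ∈ cl y, U'.indicator (1 : T → ℝ≥0∞) z = 0 := by
        intro y hy z hz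
        refine indicator_of_notMem (fun hz' => hx ?_) _
        have := hUU' z hz' y (S.cl_symm hz)
        rwa [(S.mem_ch_iff.1 hy).1] at this
      rw [Finset.sum_eq_zero]
      · simp
      · intro y hy
        rw [h1 y hy y (S.mem_cl_self y), Finset.sum_eq_zero (h1 y hy)]
        simp
  · intro y hy
    exact hU' y (by by_contra hne; simp [hne] at hy)

end

end IsTransportScheme

end Transport

/-! ### Consistent masses on all levels divisible by `m`. -/

section Solution

variable {T : Type*}

/-- A consistent family of masses on all levels divisible by `m`, normalised at `φ`. -/
structure IsMassFamily (lev : T → ℤ) (par : T → T) (ch cl : T → Finset T) (m N L : ℕ) (φ : T)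
    (h : T → ℝ≥0∞) : Prop where
  ref : h φ = 1
  le_mul : ∀ {w v}, (m : ℤ) ∣ lev w → v ∈ cl w → h w ≤ (8 * L * N) * h v
  transport : ∀ {u y}, (m : ℤ) ∣ lev u → lev y = lev u + m →
    h y = massTransport par ch cl (4 * L * N : ℝ≥0∞)⁻¹ h y

lemma massTransport_congr {par : T → T} {ch cl : T → Finset T} {δ : ℝ≥0∞} {h g : T → ℝ≥0∞} {y : T}
    (hy : h (par y) = g (par y)) (hz : ∀ z ∈ cl y, h (par z) = g (par z)) :
    massTransport par ch cl δ h y = massTransport par ch cl δ g y := by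
  unfold massTransport childMass
  rw [hy, Finset.sum_congr rfl fun z hz' => by rw [hz z hz']]

lemma massTransport_mul_const (par : T → T) (ch cl : T → Finset T) (δ : ℝ≥0∞) (h : T → ℝ≥0∞)
    (c : ℝ≥0∞) (y : T) :
    massTransport par ch cl δ (fun x => h x * c) y = massTransport par ch cl δ h y * c := by
  unfold massTransport childMass
  simp only [div_eq_mul_inv]
  rw [add_mul, mul_assoc δ, Finset.sum_mul]
  congr 1
  · ring
  · congr 1
    exact Finset.sum_congr rfl fun z _ => by ring

lemma tendsto_massTransport {par : T → T} {ch cl : T → Finset T} {δ : ℝ≥0∞} (hδ : δ ≠ ∞)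
    (hch : ∀ x, (ch x).Nonempty)
    {ι : Type*} {l : Filter ι} {G : ι → T → ℝ≥0∞} {g : T → ℝ≥0∞}
    (hG : ∀ x, Tendsto (fun i => G i x) l (𝓝 (g x))) (y : T) :
    Tendsto (fun i => massTransport par ch cl δ (G i) y) l (𝓝 (massTransport par ch cl δ g y)) := by
  have h1 : ∀ z, Tendsto (fun i => childMass par ch (G i) z) l (𝓝 (childMass par ch g z)) := by
    intro z
    refine ENNReal.Tendsto.div_const (hG _) (Or.inr ?_)
    exact_mod_cast (Finset.card_pos.2 (hch _)).ne'
  refine Tendsto.add (ENNReal.Tendsto.const_mul (h1 y) (Or.inr ?_))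
    (ENNReal.Tendsto.const_mul (tendsto_finsetSum _ fun z _ => h1 z) (Or.inr hδ))
  exact ne_top_of_le_ne_top ENNReal.one_ne_top tsub_le_self

namespace IsTransportScheme

variable {lev : T → ℤ} {par : T → T} {ch cl : T → Finset T} {m N L : ℕ}

/-- The masses obtained from the unit masses after `j` transports. -/
noncomputable def iterMass (par : T → T) (ch cl : T → Finset T) (δ : ℝ≥0∞) (j : ℕ) : T → ℝ≥0∞ :=
  (massTransport par ch cl δ)^[j] 1

lemma iterMass_succ (δ : ℝ≥0∞) (j : ℕ) : iterMass par ch cl δ (j + 1) =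
    massTransport par ch cl δ (iterMass par ch cl δ j) :=
  Function.iterate_succ_apply' _ _ _

lemma exists_lev_eq (S : IsTransportScheme lev par ch cl m N L) (u : T) (j : ℕ) :
    ∃ v, lev v = lev u + m * j := by
  induction j with
  | zero => exact ⟨u, by simp⟩
  | succ j ih =>
    obtain ⟨v, hv⟩ := ih
    obtain ⟨y, hy⟩ := S.ch_nonempty v
    exact ⟨y, by rw [(S.mem_ch_iff.1 hy).2, hv]; push_cast; ring⟩

variable [Nonempty T]

lemma one_le_comparison (S : IsTransportScheme lev par ch cl m N L) :
    (1 : ℝ≥0∞) ≤ 8 * L * N := by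
  have h1 := S.one_le_ch_bound
  have h2 := S.one_le_cl_bound
  exact_mod_cast (by nlinarith : 1 ≤ 8 * L * N)

lemma iterMass_ne_zero (S : IsTransportScheme lev par ch cl m N L) (j : ℕ) (w : T) :
    iterMass par ch cl (4 * L * N : ℝ≥0∞)⁻¹ j w ≠ 0 := by
  induction j generalizing w with
  | zero => simp [iterMass]
  | succ j ih => rw [iterMass_succ]; exact S.massTransport_ne_zero ih w

lemma iterMass_ne_top (S : IsTransportScheme lev par ch cl m N L) (j : ℕ) (w : T) :
    iterMass par ch cl (4 * L * N : ℝ≥0∞)⁻¹ j w ≠ ∞ := by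
  induction j generalizing w with
  | zero => simp [iterMass]
  | succ j ih => rw [iterMass_succ]; exact S.massTransport_ne_top ih w

lemma iterMass_le_mul (S : IsTransportScheme lev par ch cl m N L) (u : T) (j : ℕ) {w v : T}
    (hw : lev w = lev u + m * j) (hv : v ∈ cl w) :
    iterMass par ch cl (4 * L * N : ℝ≥0∞)⁻¹ j w ≤
      (8 * L * N) * iterMass par ch cl (4 * L * N : ℝ≥0∞)⁻¹ j v := by
  induction j generalizing w v with
  | zero => simpa [iterMass] using S.one_le_comparison
  | succ j ih =>
    obtain ⟨u', hu'⟩ := S.exists_lev_eq u j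
    rw [iterMass_succ]
    refine S.massTransport_le_mul (u := u') (fun w v h1 h2 => ih (h1.trans hu') h2) ?_ hv
    rw [hw, hu']; push_cast; ring

/-- Existence of a consistent family of masses: a limit of the families that start with unit masses
on the level `-m * t J`. -/
lemma exists_isMassFamily (S : IsTransportScheme lev par ch cl m N L) {φ : T} (hφ : lev φ = 0)
    (t : ℕ → ℕ) (ht : ∀ J, ∃ u, lev u = -(m * t J : ℤ))
    (ht' : ∀ u, (m : ℤ) ∣ lev u → ∀ᶠ J in atTop, -(m * t J : ℤ) ≤ lev u) :
    ∃ h, IsMassFamily lev par ch cl m N L φ h := by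
  set δ := (4 * L * N : ℝ≥0∞)⁻¹ with hδ
  have hm : (m : ℤ) ≠ 0 := by exact_mod_cast S.step_pos.ne'
  have hmpos : (0 : ℤ) < m := by exact_mod_cast S.step_pos
  set F := iterMass par ch cl δ with hF
  -- The number of transports from level `-m * t J` down to `w`. It is meaningless for `w` above the
  -- starting level, which happens only for finitely many `J` by `ht'`.
  set idx : ℕ → T → ℕ := fun J w => (t J + lev w / m).toNat with hidx
  set G : ℕ → T → ℝ≥0∞ := fun J w => F (idx J w) w * (F (t J) φ)⁻¹ with hG
  set U : Ultrafilter ℕ := hyperfilter ℕ with hU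
  have hUle : (U : Filter ℕ) ≤ atTop := by rw [hU]; exact Nat.hyperfilter_le_atTop
  -- `ℝ≥0∞` is compact, so the limit exists without estimates. The values `0` and `∞` are excluded
  -- afterwards in `IsMassFamily.ne_zero_and_ne_top`.
  have hlim : ∀ w, ∃ g, Tendsto (fun J => G J w) U (𝓝 g) := by
    intro w
    refine ⟨(U.map fun J => G J w).lim, ?_⟩
    exact (U.map fun J => G J w).le_nhds_lim
  choose g hg using hlim
  have hbase : ∀ {u : T} {J : ℕ}, (m : ℤ) ∣ lev u → -(m * t J : ℤ) ≤ lev u →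
      lev u = -(m * t J : ℤ) + m * idx J u := by
    intro u J hu hJ
    obtain ⟨i, hi⟩ := hu
    have h1 : lev u / m = i := by rw [hi]; exact Int.mul_ediv_cancel_left i hm
    have h2 : 0 ≤ (t J : ℤ) + i := by
      rw [hi] at hJ
      by_contra hneg
      nlinarith
    simp only [hidx]
    rw [h1, Int.toNat_of_nonneg h2, hi]; ring
  refine ⟨g, ?_, ?_, ?_⟩
  · refine tendsto_nhds_unique (hg φ) (tendsto_const_nhds.congr fun J => ?_)
    simp only [hG, hidx, hφ]
    rw [Int.zero_ediv, add_zero, Int.toNat_natCast,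
      ENNReal.mul_inv_cancel (S.iterMass_ne_zero _ _) (S.iterMass_ne_top _ _)]
  · intro w v hw hv
    have hA : (8 * L * N : ℝ≥0∞) ≠ ∞ :=
      ENNReal.mul_ne_top (ENNReal.mul_ne_top (by simp) (by simp)) (by simp)
    refine le_of_tendsto_of_tendsto (hg w)
      (ENNReal.Tendsto.const_mul (hg v) (Or.inr hA)) ?_
    refine Eventually.filter_mono hUle ?_
    filter_upwards [ht' w hw] with J hJ
    obtain ⟨u, hu⟩ := ht J
    have h1 : idx J v = idx J w := by simp only [hidx, S.lev_cl hv]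
    simp only [hG]
    rw [h1, ← mul_assoc]
    gcongr
    exact S.iterMass_le_mul u _ (by rw [hu]; exact hbase hw hJ) hv
  · intro u y hu hy
    refine tendsto_nhds_unique (hg y) ?_
    have h1 := tendsto_massTransport (par := par) (cl := cl) S.diffusion_ne_top S.ch_nonempty hg y
    refine h1.congr' ?_
    refine Eventually.filter_mono hUle ?_
    filter_upwards [ht' u hu] with J hJ
    have h2 : idx J y = idx J u + 1 := by
      have h3 := hbase hu hJ
      have h4 := hbase (u := y) (J := J) (by rw [hy]; exact dvd_add hu (dvd_refl _)) (by omega)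
      have h5 : (m : ℤ) * idx J y = m * (idx J u + 1 : ℕ) := by push_cast; linarith
      exact_mod_cast mul_left_cancel₀ hm h5
    have h3 : ∀ z, lev z = lev y → G J (par z) = F (idx J u) (par z) * (F (t J) φ)⁻¹ := by
      intro z hz
      simp only [hG, hidx]
      rw [S.lev_par (hz.trans hy)]
    rw [massTransport_congr (g := fun x => F (idx J u) x * (F (t J) φ)⁻¹) (h3 y rfl)
      (fun z hz => h3 z (S.lev_cl hz)), massTransport_mul_const]
    simp only [hG]
    rw [h2, hF, iterMass_succ]

end IsTransportScheme

namespace IsMassFamily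

variable {lev : T → ℤ} {par : T → T} {ch cl : T → Finset T} {m N L : ℕ} {φ : T} {h : T → ℝ≥0∞}
  [Nonempty T]

lemma par_le (H : IsMassFamily lev par ch cl m N L φ h)
    (S : IsTransportScheme lev par ch cl m N L) {u y : T} (hu : (m : ℤ) ∣ lev u)
    (hy : lev y = lev u + m) : h (par y) ≤ (2 * N) * h y := by
  rw [H.transport hu hy]
  exact S.par_le_massTransport h y

lemma le_par (H : IsMassFamily lev par ch cl m N L φ h)
    (S : IsTransportScheme lev par ch cl m N L) {u y : T} (hu : (m : ℤ) ∣ lev u)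
    (hy : lev y = lev u + m) : h y ≤ (1 + 2 * L) * h (par y) := by
  rw [H.transport hu hy]
  exact S.massTransport_le_mul_par (u := u) (fun w v hw hv => H.le_mul (by rwa [hw]) hv) hy

/-- The masses along a chain of parents are comparable. -/
lemma iterate_par_le (H : IsMassFamily lev par ch cl m N L φ h)
    (S : IsTransportScheme lev par ch cl m N L) {u y : T} (a : ℕ) (hu : (m : ℤ) ∣ lev u)
    (hy : lev y = lev u + m * a) :
    lev (par^[a] y) = lev u ∧ h (par^[a] y) ≤ (2 * N) ^ a * h y ∧
      h y ≤ (1 + 2 * L) ^ a * h (par^[a] y) := by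
  induction a generalizing y with
  | zero => simpa using hy
  | succ a ih =>
    obtain ⟨v, hv⟩ := S.exists_lev_eq u a
    have hvm : (m : ℤ) ∣ lev v := by rw [hv]; exact dvd_add hu (dvd_mul_right _ _)
    have hyv : lev y = lev v + m := by rw [hy, hv]; push_cast; ring
    obtain ⟨h1, h2, h3⟩ := ih (y := par y) (by rw [S.lev_par hyv, hv])
    rw [Function.iterate_succ_apply]
    refine ⟨h1, h2.trans ?_, (H.le_par S hvm hyv).trans ?_⟩
    · rw [pow_succ, mul_assoc]
      gcongr
      exact H.par_le S hvm hyv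
    · rw [pow_succ', mul_assoc]
      gcongr

end IsMassFamily

end Solution

/-! ### Vague limits of measures on a proper space. -/

section VagueLimit

variable {X : Type*} [MetricSpace X]

/-- A continuous function that is `1` on the closed ball of radius `r` and vanishes off the ball of
radius `s`. -/
noncomputable def ballCutoff [ProperSpace X] (x : X) (r s : ℝ) (hrs : r < s) :
    CompactlySupportedContinuousMap X ℝ where
  toFun y := max 0 (min 1 ((s - dist y x) / (s - r)))
  continuous_toFun := by fun_prop
  hasCompactSupport' := by
    refine HasCompactSupport.intro (isCompact_closedBall x s) fun y hy => ?_
    rw [Metric.mem_closedBall, not_le] at hy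
    refine max_eq_left ((min_le_right _ _).trans ?_)
    exact div_nonpos_of_nonpos_of_nonneg (by linarith) (by linarith)

section

variable [ProperSpace X] {x : X} {r s : ℝ} (hrs : r < s)

lemma ballCutoff_apply (y : X) :
    ballCutoff x r s hrs y = max 0 (min 1 ((s - dist y x) / (s - r))) := rfl

lemma ballCutoff_nonneg (y : X) : 0 ≤ ballCutoff x r s hrs y := by
  rw [ballCutoff_apply]; exact le_max_left _ _

lemma ballCutoff_le_one (y : X) : ballCutoff x r s hrs y ≤ 1 := by
  rw [ballCutoff_apply]; exact max_le zero_le_one (min_le_left _ _)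

lemma ballCutoff_eq_one {y : X} (hy : y ∈ Metric.closedBall x r) :
    ballCutoff x r s hrs y = 1 := by
  rw [ballCutoff_apply, min_eq_left, max_eq_right zero_le_one]
  rw [le_div_iff₀ (by linarith)]
  rw [Metric.mem_closedBall] at hy
  linarith

lemma ballCutoff_eq_zero {y : X} (hy : y ∉ Metric.closedBall x s) :
    ballCutoff x r s hrs y = 0 := by
  rw [Metric.mem_closedBall, not_le] at hy
  rw [ballCutoff_apply]
  refine max_eq_left ((min_le_right _ _).trans ?_)
  exact div_nonpos_of_nonpos_of_nonneg (by linarith) (by linarith)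

lemma tsupport_ballCutoff_subset : tsupport (ballCutoff x r s hrs) ⊆ Metric.closedBall x s := by
  refine closure_minimal (fun y hy => ?_) Metric.isClosed_closedBall
  by_contra hne
  exact hy (ballCutoff_eq_zero hrs hne)

variable [MeasurableSpace X] [BorelSpace X] (ν : Measure X) [IsFiniteMeasureOnCompacts ν]

lemma ofReal_integral_ballCutoff :
    ENNReal.ofReal (∫ y, ballCutoff x r s hrs y ∂ν) =
      ∫⁻ y, ENNReal.ofReal (ballCutoff x r s hrs y) ∂ν :=
  ofReal_integral_eq_lintegral_ofReal
    ((ballCutoff x r s hrs).continuous.integrable_of_hasCompactSupport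
      (ballCutoff x r s hrs).hasCompactSupport) (ae_of_all _ (ballCutoff_nonneg hrs))

lemma ofReal_integral_ballCutoff_le :
    ENNReal.ofReal (∫ y, ballCutoff x r s hrs y ∂ν) ≤ ν (Metric.closedBall x s) := by
  rw [ofReal_integral_ballCutoff, ← lintegral_indicator_one Metric.isClosed_closedBall.measurableSet]
  refine lintegral_mono fun y => ?_
  by_cases hy : y ∈ Metric.closedBall x s
  · rw [indicator_of_mem hy]
    simpa using ballCutoff_le_one hrs y
  · simp [ballCutoff_eq_zero hrs hy]

lemma le_ofReal_integral_ballCutoff :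
    ν (Metric.closedBall x r) ≤ ENNReal.ofReal (∫ y, ballCutoff x r s hrs y ∂ν) := by
  rw [ofReal_integral_ballCutoff, ← lintegral_indicator_one Metric.isClosed_closedBall.measurableSet]
  refine lintegral_mono fun y => ?_
  by_cases hy : y ∈ Metric.closedBall x r
  · rw [indicator_of_mem hy, ballCutoff_eq_one hrs hy]; simp
  · simp [hy]

end

/-- A sequence of measures that is bounded on balls has a vague limit point. -/
lemma exists_vague_limit [ProperSpace X] [MeasurableSpace X] [BorelSpace X] [Nonempty X]
    (ν : ℕ → Measure X)
    (hν : ∀ x r, ∃ B : ℝ≥0, ∀ n, ν n (Metric.closedBall x r) ≤ B) :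
    ∃ μ : Measure X,
      (∀ (x : X) (r s : ℝ) (b : ℝ≥0∞), r < s → (∀ᶠ n in atTop, ν n (Metric.closedBall x s) ≤ b) →
        μ (Metric.closedBall x r) ≤ b) ∧
      (∀ (x : X) (r s : ℝ) (a : ℝ≥0∞), r < s → (∀ᶠ n in atTop, a ≤ ν n (Metric.closedBall x r)) →
        a ≤ μ (Metric.ball x s)) := by
  have hfin : ∀ n, IsFiniteMeasureOnCompacts (ν n) := fun n => ⟨fun S hS => by
    obtain ⟨r, hr⟩ := hS.isBounded.subset_closedBall (Classical.arbitrary X)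
    obtain ⟨B, hB⟩ := hν (Classical.arbitrary X) r
    exact (measure_mono hr).trans_lt ((hB n).trans_lt ENNReal.coe_lt_top)⟩
  set U : Ultrafilter ℕ := hyperfilter ℕ with hU
  have hUle : (U : Filter ℕ) ≤ atTop := by rw [hU]; exact Nat.hyperfilter_le_atTop
  have hint : ∀ (f : CompactlySupportedContinuousMap X ℝ) n, Integrable (fun y => f y) (ν n) :=
    fun f n => f.continuous.integrable_of_hasCompactSupport f.hasCompactSupport
  have hlim : ∀ f : CompactlySupportedContinuousMap X ℝ,
      ∃ l : ℝ, Tendsto (fun n => ∫ y, f y ∂ν n) U (𝓝 l) := by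
    intro f
    obtain ⟨c, hc⟩ := f.continuous.bounded_above_of_compact_support f.hasCompactSupport
    obtain ⟨r, hr⟩ := f.hasCompactSupport.isCompact.isBounded.subset_closedBall
      (Classical.arbitrary X)
    obtain ⟨B, hB⟩ := hν (Classical.arbitrary X) r
    have hc0 : 0 ≤ c := (norm_nonneg _).trans (hc (Classical.arbitrary X))
    have hbd : ∀ n, ‖∫ y, f y ∂ν n‖ ≤ c * B := by
      intro n
      have h1 : ∫ y, f y ∂ν n = ∫ y in Metric.closedBall (Classical.arbitrary X) r, f y ∂ν n := by
        refine (setIntegral_eq_integral_of_forall_compl_eq_zero fun y hy => ?_).symm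
        by_contra hne
        exact hy (hr (subset_tsupport _ hne))
      have h2 : (ν n) (Metric.closedBall (Classical.arbitrary X) r) < ∞ :=
        (hB n).trans_lt ENNReal.coe_lt_top
      rw [h1]
      refine (norm_setIntegral_le_of_norm_le_const h2 fun y _ => hc y).trans ?_
      gcongr
      exact ENNReal.toReal_le_coe_of_le_coe (hB n)
    have hmem : ∀ n, ∫ y, f y ∂ν n ∈ Metric.closedBall (0 : ℝ) (c * B) := fun n => by
      simpa using hbd n
    obtain ⟨l, -, hl⟩ := isCompact_iff_ultrafilter_le_nhds.1
      (isCompact_closedBall (0 : ℝ) (c * B)) (U.map fun n => ∫ y, f y ∂ν n)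
      (by
        rw [le_principal_iff, Ultrafilter.coe_map, mem_map]
        exact Eventually.of_forall hmem)
    exact ⟨l, hl⟩
  choose ℓ hℓ using hlim
  -- One ultrafilter serves all test functions at once, so the limits are linear and positive and
  -- the Riesz–Markov theorem applies.
  let Λ₀ : CompactlySupportedContinuousMap X ℝ →ₗ[ℝ] ℝ :=
    { toFun := ℓ
      map_add' := fun f g => by
        refine tendsto_nhds_unique (hℓ (f + g)) (((hℓ f).add (hℓ g)).congr fun n => ?_)
        rw [← integral_add (hint f n) (hint g n)]
        rfl
      map_smul' := fun c f => by
        refine tendsto_nhds_unique (hℓ (c • f)) (((hℓ f).const_mul c).congr fun n => ?_)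
        rw [← integral_const_mul]
        rfl }
  let Λ : CompactlySupportedContinuousMap X ℝ →ₚ[ℝ] ℝ := PositiveLinearMap.mk₀ Λ₀ fun f hf =>
    ge_of_tendsto' (hℓ f) fun n => integral_nonneg fun y => hf y
  have hΛ : ∀ f, Λ f = ℓ f := fun f => rfl
  have hofReal : ∀ f, Tendsto (fun n => ENNReal.ofReal (∫ y, f y ∂ν n)) U
      (𝓝 (ENNReal.ofReal (Λ f))) := fun f => ENNReal.tendsto_ofReal (hℓ f)
  refine ⟨RealRMK.rieszMeasure Λ, fun x r s b hrs hb => ?_, fun x r s a hrs ha => ?_⟩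
  · refine (RealRMK.rieszMeasure_le_of_eq_one Λ (ballCutoff_nonneg hrs) (isCompact_closedBall x r)
      fun y hy => ballCutoff_eq_one hrs hy).trans ?_
    refine le_of_tendsto (hofReal _) (Eventually.filter_mono hUle ?_)
    filter_upwards [hb] with n hn
    exact (ofReal_integral_ballCutoff_le hrs (ν n)).trans hn
  -- The intermediate radius keeps the support of the cutoff inside the open ball.
  · have hrs' : r < (r + s) / 2 := by linarith
    refine le_trans ?_ (RealRMK.le_rieszMeasure_tsupport_subset Λ (f := ballCutoff x r _ hrs')
      (fun y => ⟨ballCutoff_nonneg _ y, ballCutoff_le_one _ y⟩)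
      ((tsupport_ballCutoff_subset hrs').trans (Metric.closedBall_subset_ball (by linarith))))
    refine ge_of_tendsto (hofReal _) (Eventually.filter_mono hUle ?_)
    filter_upwards [ha] with n hn
    exact hn.trans (le_ofReal_integral_ballCutoff hrs' (ν n))

end VagueLimit

/-! ### Measures on single levels and the displacement of mass. -/

section LevelMeasures

variable {X T : Type*} [MetricSpace X] {π : T → T} {φ : T} {K : T → Set X} {ζ : ℝ}

/-- A chain of two close pairs spans at most `(2 * H + C) * ζ ^ [y]`. Measured on the parents' scale
this gains `ζ ^ m`, so by `hmH` the parents are close with the same `H`. -/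
lemma SatisfiesBasicFramework.exists_transportScheme (hK : SatisfiesBasicFramework π φ K ζ)
    {C H : ℝ} (hC : ∀ w, ∀ x ∈ K w, ∀ y ∈ K w, dist x y ≤ C * ζ ^ treeLevel π φ w) (hH : 0 ≤ H)
    {m N L : ℕ} (hm : 0 < m) (hmH : (2 * H + C) * ζ ^ m ≤ H)
    (hL : ∀ w, {v | CellClose π φ K ζ H w v}.encard ≤ (L : ℕ∞))
    (hN : maxDescendants π φ m ≤ (N : ℕ∞)) :
    ∃ ch cl, IsTransportScheme (treeLevel π φ) (π^[m]) ch cl m N L ∧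
      ∀ w v, v ∈ cl w ↔ CellClose π φ K ζ H w v := by
  refine ⟨fun w => (hK.descendants_finite m w).toFinset,
    fun w => (finite_of_encard_le_coe (hL w)).toFinset, ?_, fun w v => by
      rw [Finite.mem_toFinset]; rfl⟩
  have hcl : ∀ w v, v ∈ (finite_of_encard_le_coe (hL w)).toFinset ↔ CellClose π φ K ζ H w v :=
    fun w v => by rw [Finite.mem_toFinset]; rfl
  have hch : ∀ w v, v ∈ (hK.descendants_finite m w).toFinset ↔
      π^[m] v = w ∧ treeLevel π φ v = treeLevel π φ w + m :=
    fun w v => by rw [Finite.mem_toFinset]; rfl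
  refine ⟨hm, fun w => ?_, fun w => ?_, fun w => ?_, fun w => ?_, fun {w v} h => ?_,
    fun {w v} h => ?_, fun {u y} h => hK.tree.treeLevel_iterate_of_inhabited h,
    fun {w v} => hch w v, fun {u y y' z} hy hy' hz => ?_⟩
  · rw [Finite.toFinset_nonempty]; exact hK.descendants_nonempty m w
  · have h := (encard_le_maxDescendants m w).trans hN
    rw [(hK.descendants_finite m w).encard_eq_coe_toFinset_card] at h
    exact_mod_cast h
  · have h := hL w
    rw [(finite_of_encard_le_coe (hL w)).encard_eq_coe_toFinset_card] at h
    exact_mod_cast h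
  · rw [hcl]
    obtain ⟨x, hx⟩ := hK.nonempty w
    exact ⟨rfl, x, hx, x, hx, by
      rw [dist_self]; exact mul_nonneg hH (hK.zpow_pos _).le⟩
  · rw [hcl] at h ⊢; exact h.symm
  · rw [hcl] at h; exact h.1.symm
  · rw [hcl] at hy' hz ⊢
    obtain ⟨l1, a, ha, b, hb, hab⟩ := hy'
    obtain ⟨l2, a', ha', c, hc, hac⟩ := hz
    have h1 := hK.tree.treeLevel_iterate_of_inhabited (l1.symm.trans hy)
    have h2 := hK.tree.treeLevel_iterate_of_inhabited (l2.symm.trans hy)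
    refine ⟨h1.trans h2.symm, b, hK.cell_subset_iterate m y' hb, c,
      hK.cell_subset_iterate m z hc, ?_⟩
    rw [h1]
    have h3 := hC y a ha a' ha'
    have hpow : ζ ^ treeLevel π φ y = ζ ^ m * ζ ^ treeLevel π φ u := by
      rw [hy, zpow_add₀ hK.ratio_pos.ne', zpow_natCast, mul_comm]
    calc dist b c ≤ dist b a + dist a a' + dist a' c := dist_triangle4 _ _ _ _
      _ ≤ (2 * H + C) * ζ ^ treeLevel π φ y := by rw [dist_comm b a]; linarith
      _ = (2 * H + C) * ζ ^ m * ζ ^ treeLevel π φ u := by rw [hpow, mul_assoc]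
      _ ≤ _ := by
        have := (hK.zpow_pos (treeLevel π φ u)).le
        gcongr

/-- A rooted tree can start at `φ` for every `J`; otherwise the starting levels tend to `-∞`. -/
lemma SatisfiesBasicFramework.exists_start_levels (hK : SatisfiesBasicFramework π φ K ζ) {m : ℕ}
    (hm : 0 < m) : ∃ t : ℕ → ℕ, (∀ J, ∃ u, treeLevel π φ u = -(m * t J : ℤ)) ∧
      ∀ u, (m : ℤ) ∣ treeLevel π φ u → ∀ᶠ J in atTop, -(m * t J : ℤ) ≤ treeLevel π φ u := by
  by_cases hφ : π φ = φ
  · refine ⟨fun _ => 0, fun _ => ⟨φ, by simpa using IsRefTree.treeLevel_ref⟩,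
      fun u _ => Eventually.of_forall fun _ => ?_⟩
    simpa using IsRefTree.treeLevel_nonneg hφ u
  · refine ⟨id, fun J => ⟨π^[m * J] φ, ?_⟩, fun u _ => ?_⟩
    · rw [hK.tree.treeLevel_iterate_of_free hφ, IsRefTree.treeLevel_ref]; push_cast; simp
    · filter_upwards [eventually_ge_atTop (-treeLevel π φ u).toNat] with J hJ
      have h1 : -treeLevel π φ u ≤ J := by omega
      have h2 : (J : ℤ) ≤ m * J := by exact_mod_cast Nat.le_mul_of_pos_left J hm
      simp only [id]
      omega

/-- Chains of `m`-step parents lead from `w` and from `φ` to a common cell. Each step changes the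
mass by bounded factors, and `h φ = 1`. -/
lemma IsMassFamily.ne_zero_and_ne_top (hK : SatisfiesBasicFramework π φ K ζ)
    {ch cl : T → Finset T} {m N L : ℕ} {h : T → ℝ≥0∞}
    (S : IsTransportScheme (treeLevel π φ) (π^[m]) ch cl m N L)
    (hh : IsMassFamily (treeLevel π φ) (π^[m]) ch cl m N L φ h) {w : T}
    (hw : (m : ℤ) ∣ treeLevel π φ w) : h w ≠ 0 ∧ h w ≠ ∞ := by
  have : Nonempty T := ⟨φ⟩
  obtain ⟨a, b, hab, h1, h2⟩ := hK.tree.exists_common_iterate w hw S.step_pos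
  set u := π^[m * a] w with hu
  have hum : (m : ℤ) ∣ treeLevel π φ u := by
    rw [h1]; exact dvd_sub hw (dvd_mul_right _ _)
  obtain ⟨-, h3, h4⟩ := hh.iterate_par_le S (u := u) (y := w) a hum (by omega)
  obtain ⟨-, h5, h6⟩ := hh.iterate_par_le S (u := u) (y := φ) b hum (by
    rw [IsRefTree.treeLevel_ref, hab, h2]; ring)
  rw [← Function.iterate_mul, ← hu] at h3 h4
  rw [← Function.iterate_mul, ← hab, hh.ref] at h5 h6
  constructor
  · intro h0
    rw [h0, mul_zero, nonpos_iff_eq_zero] at h3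
    rw [h3, mul_zero] at h6
    simp at h6
  · refine ne_top_of_le_ne_top (ENNReal.mul_ne_top ?_ (ne_top_of_le_ne_top ?_ h5)) h4
    · exact ENNReal.pow_ne_top (by finiteness)
    · rw [mul_one]; exact ENNReal.pow_ne_top (by finiteness)

variable [MeasurableSpace X]

/-- The masses of the cells of level `n`, put at the points `p w`. -/
noncomputable def levelMeasure (π : T → T) (φ : T) (h : T → ℝ≥0∞) (p : T → X) (n : ℤ) :
    Measure X :=
  Measure.sum fun w => {w | treeLevel π φ w = n}.indicator h w • Measure.dirac (p w)

omit [MetricSpace X] in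
lemma levelMeasure_apply (h : T → ℝ≥0∞) (p : T → X) (n : ℤ) {S : Set X} (hS : MeasurableSet S) :
    levelMeasure π φ h p n S =
      ∑' w, {w | treeLevel π φ w = n ∧ p w ∈ S}.indicator h w := by
  classical
  rw [levelMeasure, Measure.sum_apply _ hS]
  refine tsum_congr fun w => ?_
  rw [Measure.smul_apply, Measure.dirac_apply' _ hS, smul_eq_mul]
  by_cases h1 : treeLevel π φ w = n <;> by_cases h2 : p w ∈ S <;> simp [indicator, h1, h2]

variable [BorelSpace X] (hK : SatisfiesBasicFramework π φ K ζ) {C H : ℝ}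
  (hC : ∀ w, ∀ x ∈ K w, ∀ y ∈ K w, dist x y ≤ C * ζ ^ treeLevel π φ w)
  {m N L : ℕ} {ch cl : T → Finset T}
  (S : IsTransportScheme (treeLevel π φ) (π^[m]) ch cl m N L)
  (hcl : ∀ w v, v ∈ cl w ↔ CellClose π φ K ζ H w v)
  {h : T → ℝ≥0∞} (hh : IsMassFamily (treeLevel π φ) (π^[m]) ch cl m N L φ h)
  {p : T → X} (hp : ∀ w, p w ∈ K w)

omit [MeasurableSpace X] [BorelSpace X] in
include hK hC S hcl hp in
-- The path crosses `K z`, the gap between `K z` and `K y`, and `K w`. By `hmH1` the gap is at most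
-- one unit on the scale of `w`.
lemma dist_transport_le (hC0 : 0 ≤ C) (hmH1 : H * ζ ^ m ≤ 1) {w y z : T} (hy : y ∈ ch w)
    (hz : z ∈ cl y) : dist (p z) (p w) ≤ (2 * C + 1) * ζ ^ treeLevel π φ w := by
  obtain ⟨hyw, hlev⟩ := S.mem_ch_iff.1 hy
  obtain ⟨h1, a, ha, b, hb, hab⟩ := (hcl y z).1 hz
  have h2 := hC z _ (hp z) b hb
  have h3 := hC w a (by rw [← hyw]; exact hK.cell_subset_iterate m y ha) _ (hp w)
  have hpos := hK.zpow_pos (treeLevel π φ w)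
  have hpow : ζ ^ treeLevel π φ y = ζ ^ m * ζ ^ treeLevel π φ w := by
    rw [hlev, zpow_add₀ hK.ratio_pos.ne', zpow_natCast, mul_comm]
  have hpow1 : ζ ^ m ≤ 1 := pow_le_one₀ hK.ratio_pos.le hK.ratio_lt_one.le
  rw [← h1, hpow] at h2
  rw [hpow] at hab
  have h4 : C * (ζ ^ m * ζ ^ treeLevel π φ w) ≤ C * ζ ^ treeLevel π φ w := by
    gcongr
    exact mul_le_of_le_one_left hpos.le hpow1
  have h5 : H * (ζ ^ m * ζ ^ treeLevel π φ w) ≤ ζ ^ treeLevel π φ w := by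
    rw [← mul_assoc]; exact mul_le_of_le_one_left hpos.le hmH1
  calc dist (p z) (p w) ≤ dist (p z) b + dist b a + dist a (p w) := dist_triangle4 _ _ _ _
    _ ≤ _ := by rw [dist_comm b a]; linarith

include hK hC S hcl hh hp in
-- Enlarging a ball by the displacement of one transport captures every target of its mass, and
-- every source of it.
lemma levelMeasure_step (hC0 : 0 ≤ C) (hmH1 : H * ζ ^ m ≤ 1) {u : T}
    (hu : (m : ℤ) ∣ treeLevel π φ u) (x : X) (r : ℝ) :
    levelMeasure π φ h p (treeLevel π φ u) (Metric.closedBall x r) ≤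
      levelMeasure π φ h p (treeLevel π φ u + m)
        (Metric.closedBall x (r + (2 * C + 1) * ζ ^ treeLevel π φ u)) ∧
    levelMeasure π φ h p (treeLevel π φ u + m) (Metric.closedBall x r) ≤
      levelMeasure π φ h p (treeLevel π φ u)
        (Metric.closedBall x (r + (2 * C + 1) * ζ ^ treeLevel π φ u)) := by
  have : Nonempty T := ⟨φ⟩
  have hmeas : ∀ s, MeasurableSet (Metric.closedBall x s) :=
    fun s => Metric.isClosed_closedBall.measurableSet
  have hD : ∀ U' : Set T, (∀ y ∈ U', treeLevel π φ y = treeLevel π φ u + m) →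
      ∑' y, U'.indicator h y =
        ∑' y, U'.indicator (massTransport (π^[m]) ch cl (4 * L * N : ℝ≥0∞)⁻¹ h) y := by
    intro U' hU'
    refine tsum_congr fun y => ?_
    by_cases hy : y ∈ U'
    · rw [indicator_of_mem hy, indicator_of_mem hy, hh.transport hu (hU' y hy)]
    · rw [indicator_of_notMem hy, indicator_of_notMem hy]
  constructor
  · rw [levelMeasure_apply h p _ (hmeas _), levelMeasure_apply h p _ (hmeas _),
      hD {w | _ ∧ _} fun y hy => hy.1]
    refine S.tsum_indicator_le_massTransport h (u := u) (fun y hy => hy.1) ?_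
    rintro w ⟨hw, hwx⟩ y hy z hz
    refine ⟨?_, ?_⟩
    · rw [S.lev_cl hz, (S.mem_ch_iff.1 hy).2, hw]
    · have h1 := dist_transport_le hK hC S hcl hp hC0 hmH1 hy hz
      rw [hw] at h1
      rw [Metric.mem_closedBall] at hwx ⊢
      linarith [dist_triangle (p z) (p w) x]
  · rw [levelMeasure_apply h p _ (hmeas _), levelMeasure_apply h p _ (hmeas _),
      hD {w | _ ∧ _} fun y hy => hy.1]
    refine S.massTransport_tsum_indicator_le h (u := u) (fun y hy => hy.1) ?_
    rintro y ⟨hy, hyx⟩ z hz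
    have hlz : treeLevel π φ z = treeLevel π φ u + m := (S.lev_cl hz).trans hy
    have hlp := S.lev_par hlz
    refine ⟨hlp, ?_⟩
    have h1 := dist_transport_le hK hC S hcl hp hC0 hmH1 (w := π^[m] z)
      (S.mem_ch_iff.2 ⟨rfl, by rw [hlp, hlz]⟩) (S.cl_symm hz)
    rw [hlp] at h1
    rw [Metric.mem_closedBall] at hyx ⊢
    rw [dist_comm] at h1
    linarith [dist_triangle (π^[m] z |> p) (p y) x]

include hK hC S hcl hh hp in
-- The displacements form a geometric series of ratio `ζ ^ m`, and `hC'` makes `C'` an upper bound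
-- for its sum, uniformly in `i`.
lemma levelMeasure_iterate (hC0 : 0 ≤ C) (hmH1 : H * ζ ^ m ≤ 1) {C' : ℝ}
    (hC' : (2 * C + 1) + C' * ζ ^ m ≤ C') (i : ℕ) {u : T}
    (hu : (m : ℤ) ∣ treeLevel π φ u) (x : X) (r : ℝ) :
    levelMeasure π φ h p (treeLevel π φ u) (Metric.closedBall x r) ≤
      levelMeasure π φ h p (treeLevel π φ u + m * i)
        (Metric.closedBall x (r + C' * ζ ^ treeLevel π φ u)) ∧
    levelMeasure π φ h p (treeLevel π φ u + m * i) (Metric.closedBall x r) ≤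
      levelMeasure π φ h p (treeLevel π φ u)
        (Metric.closedBall x (r + C' * ζ ^ treeLevel π φ u)) := by
  have hpow1 : ζ ^ m < 1 := pow_lt_one₀ hK.ratio_pos.le hK.ratio_lt_one S.step_pos.ne'
  have hC'0 : 0 ≤ C' := by
    by_contra hneg
    nlinarith
  induction i generalizing u r with
  | zero =>
    have hle : r ≤ r + C' * ζ ^ treeLevel π φ u :=
      le_add_of_nonneg_right (mul_nonneg hC'0 (hK.zpow_pos _).le)
    simp only [Nat.cast_zero, mul_zero, add_zero]
    exact ⟨measure_mono (Metric.closedBall_subset_closedBall hle),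
      measure_mono (Metric.closedBall_subset_closedBall hle)⟩
  | succ i ih =>
    obtain ⟨v, hv⟩ := S.exists_lev_eq u 1
    have hv : treeLevel π φ v = treeLevel π φ u + m := by rw [hv]; simp
    have hvm : (m : ℤ) ∣ treeLevel π φ v := by rw [hv]; exact dvd_add hu (dvd_refl _)
    have hlev : treeLevel π φ u + m * ((i + 1 : ℕ) : ℤ) = treeLevel π φ v + m * i := by
      rw [hv]; push_cast; ring
    have hrad : (2 * C + 1) * ζ ^ treeLevel π φ u + C' * ζ ^ treeLevel π φ v ≤
        C' * ζ ^ treeLevel π φ u := by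
      rw [hv, zpow_add₀ hK.ratio_pos.ne', zpow_natCast]
      have := hK.zpow_pos (treeLevel π φ u)
      nlinarith
    rw [hlev]
    constructor
    · refine (levelMeasure_step hK hC S hcl hh hp hC0 hmH1 hu x r).1.trans ?_
      rw [← hv]
      refine (ih hvm _).1.trans (measure_mono (Metric.closedBall_subset_closedBall ?_))
      linarith
    · refine (ih hvm r).2.trans ?_
      rw [hv]
      refine (levelMeasure_step hK hC S hcl hh hp hC0 hmH1 hu x _).2.trans
        (measure_mono (Metric.closedBall_subset_closedBall ?_))
      rw [← hv]
      linarith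

include hK S hh hp in
lemma levelMeasure_closedBall_lt_top {u : T} (hu : (m : ℤ) ∣ treeLevel π φ u) (x : X) (r : ℝ) :
    levelMeasure π φ h p (treeLevel π φ u) (Metric.closedBall x r) < ∞ := by
  obtain ⟨w, hw, hxw⟩ := hK.exists_cell_mem u x
  obtain ⟨L', hL'⟩ := hK.exists_close_bound
    (H := |r| / ζ ^ treeLevel π φ u) (div_nonneg (abs_nonneg _) (hK.zpow_pos _).le)
  have hfin := finite_of_encard_le_coe (hL' w)
  have hpos := hK.zpow_pos (treeLevel π φ u)
  rw [levelMeasure_apply h p _ Metric.isClosed_closedBall.measurableSet,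
    tsum_eq_sum (s := hfin.toFinset)]
  · refine ENNReal.sum_lt_top.2 fun v _ => ?_
    by_cases hv : v ∈ {w | treeLevel π φ w = treeLevel π φ u ∧ p w ∈ Metric.closedBall x r}
    · rw [indicator_of_mem hv]
      exact (hh.ne_zero_and_ne_top hK S (by rw [hv.1]; exact hu)).2.lt_top
    · rw [indicator_of_notMem hv]; exact ENNReal.zero_lt_top
  · intro v hv
    refine indicator_of_notMem (fun hv' => hv ?_) _
    rw [Finite.mem_toFinset]
    refine ⟨hw.trans hv'.1.symm, x, hxw, p v, hp v, ?_⟩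
    rw [hw, div_mul_cancel₀ _ hpos.ne', dist_comm]
    exact (Metric.mem_closedBall.1 hv'.2).trans (le_abs_self r)

include hcl S hh hp in
-- Only cells close to `w` have their point in this ball; there are at most `L`, with masses
-- comparable to `h w`.
lemma levelMeasure_closedBall_le {w : T} (hw : (m : ℤ) ∣ treeLevel π φ w) {x : X} (hx : x ∈ K w) :
    levelMeasure π φ h p (treeLevel π φ w) (Metric.closedBall x (H * ζ ^ treeLevel π φ w)) ≤
      L * ((8 * L * N) * h w) := by
  rw [levelMeasure_apply h p _ Metric.isClosed_closedBall.measurableSet,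
    tsum_eq_sum (s := cl w)]
  · calc _ ≤ ∑ v ∈ cl w, (8 * L * N) * h w := by
          refine Finset.sum_le_sum fun v hv => (indicator_le_self _ _ v).trans ?_
          exact hh.le_mul (by rw [S.lev_cl hv]; exact hw) (S.cl_symm hv)
      _ = (cl w).card * ((8 * L * N) * h w) := by rw [Finset.sum_const, nsmul_eq_mul]
      _ ≤ _ := by gcongr; exact_mod_cast S.cl_card_le w
  · intro v hv
    refine indicator_of_notMem (fun hv' => hv ?_) _
    rw [hcl]
    refine ⟨hv'.1.symm, x, hx, p v, hp v, ?_⟩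
    rw [dist_comm]
    exact Metric.mem_closedBall.1 hv'.2

include hC hp in
lemma le_levelMeasure_closedBall {w : T} {x : X} (hx : x ∈ K w) :
    h w ≤ levelMeasure π φ h p (treeLevel π φ w)
      (Metric.closedBall x (C * ζ ^ treeLevel π φ w)) := by
  rw [levelMeasure_apply h p _ Metric.isClosed_closedBall.measurableSet]
  refine le_trans (le_of_eq ?_) (ENNReal.le_tsum w)
  rw [indicator_of_mem]
  exact ⟨rfl, hC w _ (hp w) x hx⟩

end LevelMeasures

/-! ### Upper bound: the limit measure and its volume ratios. -/

section UpperBound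

variable {X T : Type*} [MetricSpace X] [MeasurableSpace X] [BorelSpace X]
  {π : T → T} {φ : T} {K : T → Set X} {ζ : ℝ}

/-- A measure whose balls are comparable to the masses of the cells of the same size. -/
lemma SatisfiesBasicFramework.exists_measure_of_massFamily (hK : SatisfiesBasicFramework π φ K ζ)
    {C C' : ℝ} (hC0 : 0 < C)
    (hC : ∀ w, ∀ x ∈ K w, ∀ y ∈ K w, dist x y ≤ C * ζ ^ treeLevel π φ w)
    {m N L : ℕ} {ch cl : T → Finset T}
    (S : IsTransportScheme (treeLevel π φ) (π^[m]) ch cl m N L)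
    (hcl : ∀ w v, v ∈ cl w ↔ CellClose π φ K ζ (5 * C') w v)
    (hmH1 : 5 * C' * ζ ^ m ≤ 1) (hC' : (2 * C + 1) + C' * ζ ^ m ≤ C')
    {h : T → ℝ≥0∞} (hh : IsMassFamily (treeLevel π φ) (π^[m]) ch cl m N L φ h) :
    ∃ μ : Measure X, (∀ x r, μ (Metric.ball x r) < ∞) ∧
      (∀ w x r, (m : ℤ) ∣ treeLevel π φ w → x ∈ K w → r ≤ 2 * C' * ζ ^ treeLevel π φ w →
        μ (Metric.ball x r) ≤ L * ((8 * L * N) * h w)) ∧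
      (∀ w x r, (m : ℤ) ∣ treeLevel π φ w → x ∈ K w → 2 * C' * ζ ^ treeLevel π φ w < r →
        h w ≤ μ (Metric.ball x r)) := by
  have := hK.properSpace
  obtain ⟨x₀, -⟩ := hK.nonempty φ
  have : Nonempty X := ⟨x₀⟩
  choose p hp using hK.nonempty
  have hpow := pow_pos hK.ratio_pos m
  have hCC' : C ≤ C' ∧ 0 < C' := by
    have hpow1 : ζ ^ m < 1 := pow_lt_one₀ hK.ratio_pos.le hK.ratio_lt_one S.step_pos.ne'
    have h0 : 0 < C' := by
      by_contra hneg
      nlinarith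
    exact ⟨by nlinarith, h0⟩
  have hlev : ∀ w, (m : ℤ) ∣ treeLevel π φ w → ∀ᶠ j : ℕ in atTop,
      ∃ i : ℕ, (m * j : ℤ) = treeLevel π φ w + m * i := by
    rintro w ⟨a, ha⟩
    filter_upwards [eventually_ge_atTop a.toNat] with j hj
    refine ⟨(j - a).toNat, ?_⟩
    rw [ha, Int.toNat_of_nonneg (by omega)]; ring
  obtain ⟨μ, hμ1, hμ2⟩ := exists_vague_limit (fun j : ℕ => levelMeasure π φ h p (m * j : ℤ))
    (fun x r => by
      have hfin := levelMeasure_closedBall_lt_top hK S hh hp (u := φ)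
        (by rw [IsRefTree.treeLevel_ref]; exact dvd_zero _) x (r + C' * ζ ^ treeLevel π φ φ)
      obtain ⟨B, hB⟩ := ENNReal.lt_iff_exists_coe.1 hfin
      refine ⟨B, fun j => ?_⟩
      rw [← hB.1]
      have h1 := (levelMeasure_iterate hK hC S hcl hh hp hC0.le hmH1 hC' j (u := φ)
        (by rw [IsRefTree.treeLevel_ref]; exact dvd_zero _) x r).2
      rwa [show treeLevel π φ φ + (m : ℤ) * j = m * j by rw [IsRefTree.treeLevel_ref, zero_add]] at h1)
  refine ⟨μ, fun x r => ?_, fun w x r hw hx hr => ?_, fun w x r hw hx hr => ?_⟩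
  · have hfin := levelMeasure_closedBall_lt_top hK S hh hp (u := φ)
      (by rw [IsRefTree.treeLevel_ref]; exact dvd_zero _) x (r + 1 + C' * ζ ^ treeLevel π φ φ)
    refine (measure_mono Metric.ball_subset_closedBall).trans_lt
      ((hμ1 x r (r + 1) _ (by linarith) (Eventually.of_forall fun j => ?_)).trans_lt hfin)
    have h1 := (levelMeasure_iterate hK hC S hcl hh hp hC0.le hmH1 hC' j (u := φ)
      (by rw [IsRefTree.treeLevel_ref]; exact dvd_zero _) x (r + 1)).2
    rwa [show treeLevel π φ φ + (m : ℤ) * j = m * j by rw [IsRefTree.treeLevel_ref, zero_add]] at h1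
  -- The radius `2 * C'` is enlarged to `4 * C'` for the vague limit and by `C'` for the
  -- displacement, which explains `5 * C'` in the closeness.
  · have hpos := mul_pos hCC'.2 (hK.zpow_pos (treeLevel π φ w))
    refine (measure_mono Metric.ball_subset_closedBall).trans
      (hμ1 x r (4 * C' * ζ ^ treeLevel π φ w) _ (by nlinarith) ?_)
    filter_upwards [hlev w hw] with j ⟨i, hi⟩
    rw [hi]
    refine (levelMeasure_iterate hK hC S hcl hh hp hC0.le hmH1 hC' i hw x _).2.trans ?_
    rw [← add_mul, show 4 * C' + C' = 5 * C' by ring]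
    exact levelMeasure_closedBall_le S hcl hh hp hw hx
  -- The chosen point of `w` is within `C` of `x` on this scale, and `C + C' ≤ 2 * C'` includes the
  -- displacement.
  · refine hμ2 x _ r _ hr ?_
    filter_upwards [hlev w hw] with j ⟨i, hi⟩
    rw [hi]
    refine (le_levelMeasure_closedBall hC hp hx).trans
      ((levelMeasure_iterate hK hC S hcl hh hp hC0.le hmH1 hC' i hw x _).1.trans
        (measure_mono (Metric.closedBall_subset_closedBall ?_)))
    have := hK.zpow_pos (treeLevel π φ w)
    nlinarith [hCC'.1]

/-- For every `ε > 0` there is a measure on `X` the volume ratios of which grow at most like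
`(N_* + ε) ^ k`. -/
lemma SatisfiesBasicFramework.exists_measure_ball_le (hK : SatisfiesBasicFramework π φ K ζ)
    {ε : ℝ≥0} (hε : 0 < ε) :
    ∃ μ : Measure X, (∀ x r, 0 < r → 0 < μ (Metric.ball x r) ∧ μ (Metric.ball x r) < ∞) ∧
      ∃ B : ℝ≥0, ∀ (k : ℕ) x r, 0 < r → μ (Metric.ball x r) ≤
        B * (NStar π φ + ε) ^ k * μ (Metric.ball x (ζ ^ k * r)) := by
  have : Nonempty T := ⟨φ⟩
  obtain ⟨C, hC0, hC⟩ := hK.exists_diam_bound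
  have hζ0 := hK.ratio_pos
  have hζ1 := hK.ratio_lt_one
  -- Solves `(2 * C + 1) + C' * ζ = C'`. As `ζ ^ m ≤ ζ`, it bounds the total displacement for every
  -- `m ≥ 1`, so it can be fixed before `m`.
  set C' : ℝ := (2 * C + 1) / (1 - ζ) with hC'def
  have h1ζ : 0 < 1 - ζ := by linarith
  have hC'0 : 0 < C' := by positivity
  have hC'eq : C' * (1 - ζ) = 2 * C + 1 := div_mul_cancel₀ _ h1ζ.ne'
  have hCC' : C < C' := by nlinarith
  obtain ⟨L, hL⟩ := hK.exists_close_bound (H := 5 * C') (by positivity)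
  have htend : Tendsto (fun k : ℕ => ζ ^ k) atTop (𝓝 0) :=
    tendsto_pow_atTop_nhds_zero_of_lt_one hζ0.le hζ1
  obtain ⟨m, hm1, hm2, hm3, hm0⟩ : ∃ m : ℕ, 2 * (maxDescendants π φ m : ℝ≥0∞) ≤
      (NStar π φ + ε) ^ m ∧ (2 * (5 * C') + C) * ζ ^ m ≤ 5 * C' ∧ 5 * C' * ζ ^ m ≤ 1 ∧ 0 < m := by
    have e1 : ∀ᶠ m : ℕ in atTop, (2 * (5 * C') + C) * ζ ^ m ≤ 5 * C' := by
      have := htend.const_mul (2 * (5 * C') + C)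
      rw [mul_zero] at this
      exact (this.eventually_lt_const (show 0 < 5 * C' by positivity)).mono fun _ h => h.le
    have e2 : ∀ᶠ m : ℕ in atTop, 5 * C' * ζ ^ m ≤ 1 := by
      have := htend.const_mul (5 * C')
      rw [mul_zero] at this
      exact (this.eventually_lt_const one_pos).mono fun _ h => h.le
    exact ((hK.eventually_maxDescendants_le hε).and
      (e1.and (e2.and (eventually_gt_atTop 0)))).exists
  obtain ⟨N, hN⟩ : ∃ N : ℕ, maxDescendants π φ m = N := by
    obtain ⟨N', -, hN'⟩ := hK.exists_maxDescendants_le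
    refine ⟨_, (ENat.natCast_toNat (ne_top_of_le_ne_top ?_ (hN' m))).symm⟩
    exact_mod_cast ENat.natCast_ne_top (N' ^ m)
  obtain ⟨ch, cl, S, hcl⟩ := hK.exists_transportScheme hC (by positivity) hm0 hm2 hL hN.le
  obtain ⟨t, ht, ht'⟩ := hK.exists_start_levels hm0
  obtain ⟨h, hh⟩ := S.exists_isMassFamily IsRefTree.treeLevel_ref t ht ht'
  have hmζ : ζ ^ m ≤ ζ := pow_le_of_le_one hζ0.le hζ1.le hm0.ne'
  obtain ⟨μ, hμfin, hμup, hμlow⟩ := hK.exists_measure_of_massFamily hC0 hC S hcl hm3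
    (by nlinarith) hh
  set s : ℝ≥0∞ := NStar π φ + ε with hs
  have hs1 : 1 ≤ s := hK.one_le_NStar.trans le_self_add
  have hsfin : s ≠ ∞ := ENNReal.add_ne_top.2 ⟨hK.NStar_ne_top, ENNReal.coe_ne_top⟩
  have hNs : (2 * N : ℝ≥0∞) ≤ s ^ m := by
    refine le_trans (le_of_eq ?_) hm1
    rw [hN]; simp
  have hmZ : (0 : ℤ) < m := by exact_mod_cast hm0
  have hpos : ∀ x r, 0 < r → 0 < μ (Metric.ball x r) := by
    intro x r hr
    have e1 : ∀ᶠ k : ℕ in atTop, 2 * C' * ζ ^ k < r := by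
      have := htend.const_mul (2 * C')
      rw [mul_zero] at this
      exact this.eventually_lt_const hr
    obtain ⟨k, hk⟩ := e1.exists
    obtain ⟨u, hu⟩ := S.exists_lev_eq φ k
    rw [IsRefTree.treeLevel_ref, zero_add] at hu
    obtain ⟨w, hw, hxw⟩ := hK.exists_cell_mem u x
    rw [hu] at hw
    have hwm : (m : ℤ) ∣ treeLevel π φ w := by rw [hw]; exact dvd_mul_right _ _
    refine lt_of_lt_of_le (pos_iff_ne_zero.2 (hh.ne_zero_and_ne_top hK S hwm).1)
      (hμlow w x r hwm hxw (lt_of_le_of_lt ?_ hk))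
    rw [hw]
    have : ζ ^ ((m : ℤ) * k) ≤ ζ ^ k := by
      rw [← zpow_natCast ζ k]
      refine zpow_le_zpow_right_of_le_one₀ hζ0 hζ1.le ?_
      exact_mod_cast Nat.le_mul_of_pos_left k hm0
    gcongr
  set B : ℝ≥0∞ := L * (8 * L * N) * s ^ (2 * m) with hB
  have hBtop : B ≠ ∞ := ENNReal.mul_ne_top (by finiteness) (ENNReal.pow_ne_top hsfin)
  -- the estimate for radii comparable to the size of a cell
  have hcell : ∀ (k : ℕ) (w : T) (x : X) (r : ℝ), (m : ℤ) ∣ treeLevel π φ w → x ∈ K w →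
      r ≤ 2 * C' * ζ ^ treeLevel π φ w → 2 * C' * ζ ^ (treeLevel π φ w + m) < r →
      μ (Metric.ball x r) ≤ B * s ^ k * μ (Metric.ball x (ζ ^ k * r)) := by
    intro k w x r hwm hxw hr1 hr2
    -- One extra step rounds `k / m` up; the other is needed because `r` may be smaller than the
    -- scale of `w` by nearly `ζ ^ m`.
    set i := k / m + 2 with hi
    have hki : m + k ≤ m * i := by
      have h1 : k ≤ m * (k / m + 1) := (Nat.lt_mul_div_succ k hm0).le
      calc m + k ≤ m + m * (k / m + 1) := by omega
        _ = m * i := by rw [hi]; ring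
    have hik : m * i ≤ k + 2 * m := by
      have h1 : m * (k / m) ≤ k := Nat.mul_div_le k m
      calc m * i = m * (k / m) + 2 * m := by rw [hi]; ring
        _ ≤ _ := by omega
    obtain ⟨v, hv, hxv⟩ := hK.exists_mem_descendants (m * i) hxw
    have hvl : treeLevel π φ v = treeLevel π φ w + m * i := by rw [hv.2]; push_cast; ring
    have hvm : (m : ℤ) ∣ treeLevel π φ v := by
      rw [hvl]; exact dvd_add hwm (dvd_mul_right _ _)
    obtain ⟨-, h2, -⟩ := hh.iterate_par_le S (u := w) (y := v) i hwm hvl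
    rw [← Function.iterate_mul, hv.1] at h2
    have h3 : h v ≤ μ (Metric.ball x (ζ ^ k * r)) := by
      refine hμlow v x _ hvm hxv ?_
      have h4 : ζ ^ treeLevel π φ v ≤ ζ ^ k * ζ ^ (treeLevel π φ w + m) := by
        rw [← zpow_natCast ζ k, ← zpow_add₀ hζ0.ne']
        refine zpow_le_zpow_right_of_le_one₀ hζ0 hζ1.le ?_
        rw [hvl]
        have : (m : ℤ) + k ≤ m * i := by exact_mod_cast hki
        omega
      calc 2 * C' * ζ ^ treeLevel π φ v
          ≤ 2 * C' * (ζ ^ k * ζ ^ (treeLevel π φ w + m)) := by gcongr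
        _ = ζ ^ k * (2 * C' * ζ ^ (treeLevel π φ w + m)) := by ring
        _ < ζ ^ k * r := by
          have := pow_pos hζ0 k
          gcongr
    have hNi : (2 * N : ℝ≥0∞) ^ i ≤ s ^ (k + 2 * m) := by
      calc (2 * N : ℝ≥0∞) ^ i ≤ (s ^ m) ^ i := by gcongr
        _ = s ^ (m * i) := (pow_mul _ _ _).symm
        _ ≤ _ := pow_le_pow_right₀ hs1 hik
    calc μ (Metric.ball x r) ≤ L * ((8 * L * N) * h w) := hμup w x r hwm hxw hr1
      _ ≤ L * ((8 * L * N) * (s ^ (k + 2 * m) * μ (Metric.ball x (ζ ^ k * r)))) := by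
        gcongr
        exact h2.trans (mul_le_mul' hNi h3)
      _ = _ := by rw [hB, pow_add]; ring
  refine ⟨μ, fun x r hr => ⟨hpos x r hr, hμfin x r⟩, B.toNNReal, fun k x r hr => ?_⟩
  rw [ENNReal.coe_toNNReal hBtop]
  -- Only the negative levels of a rooted tree are empty.
  have hinh : ∀ a : ℤ, (π φ = φ → 0 ≤ a) → ∃ u, treeLevel π φ u = m * a := by
    intro a ha
    by_cases h0 : 0 ≤ a
    · obtain ⟨u, hu⟩ := S.exists_lev_eq φ a.toNat
      exact ⟨u, by rw [hu, IsRefTree.treeLevel_ref, Int.toNat_of_nonneg h0, zero_add]⟩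
    · have hφ : π φ ≠ φ := fun e => h0 (ha e)
      refine ⟨π^[m * (-a).toNat] φ, ?_⟩
      rw [hK.tree.treeLevel_iterate_of_free hφ, IsRefTree.treeLevel_ref]
      push_cast
      rw [Int.toNat_of_nonneg (by omega)]; ring
  have hlevel : ∀ (a : ℤ) (r : ℝ), (π φ = φ → 0 ≤ a) → 2 * C' * ζ ^ (m * (a + 1)) < r →
      r ≤ 2 * C' * ζ ^ (m * a) →
      μ (Metric.ball x r) ≤ B * s ^ k * μ (Metric.ball x (ζ ^ k * r)) := by
    intro a r ha hr1 hr2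
    obtain ⟨u, hu⟩ := hinh a ha
    obtain ⟨w, hw, hxw⟩ := hK.exists_cell_mem u x
    rw [hu] at hw
    refine hcell k w x r (by rw [hw]; exact dvd_mul_right _ _) hxw (by rwa [hw]) ?_
    rwa [hw, ← mul_add_one]
  obtain ⟨a, ha1, ha2⟩ : ∃ a : ℤ, 2 * C' * ζ ^ (m * (a + 1)) < r ∧ r ≤ 2 * C' * ζ ^ (m * a) := by
    have hpow := pow_pos hζ0 m
    have hy : 1 < (ζ ^ m)⁻¹ := (one_lt_inv₀ hpow).2 (hmζ.trans_lt hζ1)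
    obtain ⟨b, hb1, hb2⟩ := exists_mem_Ioc_zpow (show 0 < r / (2 * C') by positivity) hy
    have hz : ∀ c : ℤ, ((ζ ^ m)⁻¹) ^ c = ζ ^ (m * -c) := fun c => by
      rw [inv_zpow', ← zpow_natCast ζ m, ← zpow_mul]
    rw [hz, lt_div_iff₀' (by positivity)] at hb1
    rw [hz, div_le_iff₀' (by positivity)] at hb2
    refine ⟨-(b + 1), ?_, hb2⟩
    rwa [show -(b + 1) + 1 = -b by ring]
  by_cases hcase : π φ = φ → 0 ≤ a
  · exact hlevel a r hcase ha1 ha2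
  · push Not at hcase
    obtain ⟨hφ, ha0⟩ := hcase
    -- here the ball is the whole space
    have hr2C : 2 * C' < r := by
      refine lt_of_le_of_lt ?_ ha1
      have h1 : 1 ≤ ζ ^ ((m : ℤ) * (a + 1)) := by
        rw [← zpow_zero ζ]
        refine zpow_le_zpow_right_of_le_one₀ hζ0 hζ1.le ?_
        exact mul_nonpos_of_nonneg_of_nonpos hmZ.le (by omega)
      nlinarith
    have hmemφ : ∀ y : X, y ∈ K φ := fun y => by
      obtain ⟨w, hw, hyw⟩ := hK.exists_cell_mem φ y
      rwa [hK.tree.eq_ref_of_treeLevel_eq_zero hφ (hw.trans IsRefTree.treeLevel_ref)] at hyw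
    have hball : Metric.ball x (2 * C') = univ := by
      refine eq_univ_of_forall fun y => ?_
      have h1 := hC φ y (hmemφ y) x (hmemφ x)
      rw [IsRefTree.treeLevel_ref, zpow_zero, mul_one] at h1
      rw [Metric.mem_ball]
      linarith
    calc μ (Metric.ball x r) ≤ μ (Metric.ball x (2 * C')) := by
          rw [hball]; exact measure_mono (subset_univ _)
      _ ≤ B * s ^ k * μ (Metric.ball x (ζ ^ k * (2 * C'))) := by
        refine hlevel 0 (2 * C') (fun _ => le_rfl) ?_ (by simp)
        rw [zero_add, mul_one, zpow_natCast]
        have := hmζ.trans_lt hζ1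
        nlinarith
      _ ≤ _ := by
        gcongr

end UpperBound

theorem proposition3p11 {X T : Type*} [MetricSpace X] [MeasurableSpace X] [BorelSpace X]
    (π : T → T) (φ : T) (K : T → Set X) (ζ : ℝ) (hK : SatisfiesBasicFramework π φ K ζ) :
    (∃ c : ℝ≥0, 0 < c ∧ ∀ μ : Measure X, IsVolumeDoubling μ → ∀ k : ℕ,
      (c : ℝ≥0∞) * NStar π φ ^ k ≤ volumeRatioSup μ ζ k) ∧
    (∀ ε : ℝ≥0, 0 < ε → ∃ μ : Measure X, IsVolumeDoubling μ ∧ ∃ C : ℝ≥0, 0 < C ∧ ∀ k : ℕ,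
      volumeRatioSup μ ζ k ≤ (C : ℝ≥0∞) * (NStar π φ + (ε : ℝ≥0∞)) ^ k) := by
  refine ⟨hK.exists_mul_NStar_pow_le_volumeRatioSup, fun ε hε => ?_⟩
  obtain ⟨μ, hμ, B, hB⟩ := hK.exists_measure_ball_le hε
  obtain ⟨s, hs⟩ : ∃ s : ℝ≥0, (s : ℝ≥0∞) = NStar π φ + ε :=
    ⟨_, ENNReal.coe_toNNReal (ENNReal.add_ne_top.2 ⟨hK.NStar_ne_top, ENNReal.coe_ne_top⟩)⟩
  refine ⟨μ, ?_, B + 1, by positivity, fun k => ?_⟩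
  -- Doubling is the growth estimate at radius `2 * r`, since `ζ ^ k * (2 * r) ≤ r`; the summand `2`
  -- only makes the constant exceed `1`.
  · obtain ⟨k, hk⟩ := exists_pow_lt_of_lt_one (show (0 : ℝ) < 1 / 2 by norm_num) hK.ratio_lt_one
    refine ⟨B * s ^ k + 2, lt_of_lt_of_le one_lt_two le_add_self, fun x r hr =>
      ⟨(hμ x _ (by positivity)).1, ?_,
        ENNReal.mul_lt_top ENNReal.coe_lt_top (hμ x r hr).2⟩⟩
    refine (hB k x (2 * r) (by positivity)).trans ?_
    rw [← hs]
    push_cast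
    gcongr
    · exact le_self_add
    · nlinarith
  · refine iSup_le fun x => iSup₂_le fun r hr => ENNReal.div_le_of_le_mul ?_
    refine (hB k x r hr.1).trans ?_
    gcongr
    exact le_self_add
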